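/- For $p=(a,b,c,d,e,f,\alpha,\beta,\gamma,\delta)\in\mathbf C^{10}$ consider the fourth-order differential operator \[L_p=\theta^4+x\,(a\theta^4+b\theta^3+c\theta^2+d\theta+e)+f x^2(\theta+\alpha)(\theta+\beta)(\theta+\gamma)(\theta+\delta),\qquad \theta=x\tfrac{d}{dx}.\] After division by its leading coefficient $x^4(1+ax+fx^2)$ the operator reads $y^{(iv)}+a_3y'''+a_2y''+a_1y'+a_0y$ with rational functions $a_i\in\mathbf C(x)$. Put \[\mathcal Q=\tfrac12a_2a_3-a_1-\tfrac18a_3^3+a_2'-\tfrac34a_3a_3'-\tfrac12a_3'' ,\] and let $X\subset\mathbf C^{10}$ be the set of all $p$ for which $\mathcal Q=0$ identically in $x$ (the Calabi–Yau condition). Let $\sigma=\tfrac12(\alpha+\beta+\gamma+\delta)$, twice the average exponent at infinity. The symmetric group $S_4$ acts on $\mathbf C^{10}$ by permuting the exponents $\alpha,\beta,\gamma,\delta$; this does not change the operator. **Theorem.** $X$ is an algebraic set. Up to permutation of the exponents, $X$ is the union of ten irreducible components: $X$ is the union of its irreducible components, and these form exactly ten $S_4$-orbits. Three of the ten orbits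 consist of components contained in $\{f=0\}$; the other seven consist of components on which $f$ is not identically zero. These seven are, up to permutation of the exponents, * one transverse component, on which $\sigma$ is not constant; it has dimension $5$; * six components on each of which $\sigma$ is constant; the pairs $(\sigma,\dim)$ are $(0,4)$, $(1,5)$, $(2,6)$, $(3,5)$, $(2,4)$, $(4,4)$. The $6$-dimensional component with $\sigma=2$ (the main component) is the family of all operators \[\theta^4+x\,(a\theta^4+2a\theta^3+(a+d)\theta^2+d\theta+e)+fx^2(\theta+\alpha)(\theta+\beta)(\theta+2-\alpha)(\theta+2-\beta),\qquad a,d,e,f,\alpha,\beta\in\mathbf C .\] -/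

import Mathlib

open MvPolynomial (zeroLocus vanishingIdeal)

noncomputable section

namespace CYDegreeTwo

/-- The parameter space `ℂ¹⁰`: a point `p` consists of the six coefficients
`(a, b, c, d, e, f) = (p (inl 0), …, p (inl 5))` and the four exponents
`(α, β, γ, δ) = (p (inr 0), …, p (inr 3))`. -/
abbrev Param : Type := Fin 6 ⊕ Fin 4 → ℂ

/-! ### The operator and the Calabi–Yau condition -/

section Operator

open Polynomial

/-- `P₀(θ) = θ⁴`. -/
def P₀ : ℂ[X] := X ^ 4

/-- `P₁(θ) = aθ⁴ + bθ³ + cθ² + dθ + e`. -/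
def P₁ (p : Param) : ℂ[X] :=
  C (p (.inl 0)) * X ^ 4 + C (p (.inl 1)) * X ^ 3 + C (p (.inl 2)) * X ^ 2
    + C (p (.inl 3)) * X + C (p (.inl 4))

/-- `P₂(θ) = f(θ + α)(θ + β)(θ + γ)(θ + δ)`. -/
def P₂ (p : Param) : ℂ[X] :=
  C (p (.inl 5)) * ∏ i : Fin 4, (X + C (p (.inr i)))

end Operator

/-- The coefficient of `θᵏ` in the operator `P₀(θ) + x P₁(θ) + x² P₂(θ)`. -/
def thetaCoeff (p : Param) (k : ℕ) (x : ℂ) : ℂ :=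
  P₀.coeff k + x * (P₁ p).coeff k + x ^ 2 * (P₂ p).coeff k

/-- The coefficient of `(d/dx)ʲ` in the same operator. Since `θ = x d/dx`, one has
`θᵏ = ∑ⱼ S(k, j) xʲ (d/dx)ʲ` with `S(k, j)` the Stirling numbers of the second kind. -/
def derivCoeff (p : Param) (j : ℕ) (x : ℂ) : ℂ :=
  x ^ j * ∑ k ∈ Finset.range 5, (Nat.stirlingSecond k j : ℂ) * thetaCoeff p k x

/-- The coefficient `aⱼ(x)` of the monic form `y⁗ + a₃ y‴ + a₂ y″ + a₁ y′ + a₀ y`; the leading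
coefficient divided out is `x⁴ (1 + a x + f x²)`. -/
def monicCoeff (p : Param) (j : ℕ) (x : ℂ) : ℂ :=
  derivCoeff p j x / derivCoeff p 4 x

/-- `𝒬 = ½ a₂ a₃ - a₁ - ⅛ a₃³ + a₂′ - ¾ a₃ a₃′ - ½ a₃″`. -/
def calQ (p : Param) (x : ℂ) : ℂ :=
  1 / 2 * monicCoeff p 2 x * monicCoeff p 3 x - monicCoeff p 1 x
    - 1 / 8 * monicCoeff p 3 x ^ 3 + deriv (monicCoeff p 2) x
    - 3 / 4 * monicCoeff p 3 x * deriv (monicCoeff p 3) x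
    - 1 / 2 * deriv (deriv (monicCoeff p 3)) x

/-- The set `X ⊂ ℂ¹⁰` of parameters for which the rational function `𝒬` vanishes identically,
that is, at every point where its denominator does not vanish. -/
def cySet : Set Param :=
  {p | ∀ x : ℂ, derivCoeff p 4 x ≠ 0 → calQ p x = 0}

/-! ### Algebraic sets, irreducible components, dimension -/

/-- `Z` is an algebraic set, i.e. Zariski closed in `ℂ¹⁰`. -/
def IsAlgebraicSet (Z : Set Param) : Prop :=
  ∃ I : Ideal (MvPolynomial (Fin 6 ⊕ Fin 4) ℂ), Z = zeroLocus ℂ I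

/-- `Z` is an irreducible algebraic set. -/
def IsIrreducibleAlgebraicSet (Z : Set Param) : Prop :=
  IsAlgebraicSet Z ∧ Z.Nonempty ∧
    ∀ Z₁ Z₂ : Set Param, IsAlgebraicSet Z₁ → IsAlgebraicSet Z₂ → Z ⊆ Z₁ ∪ Z₂ →
      Z ⊆ Z₁ ∨ Z ⊆ Z₂

/-- `Z` is an irreducible component of `X`: a maximal irreducible algebraic subset. -/
def IsComponent (X Z : Set Param) : Prop :=
  Maximal (fun W => IsIrreducibleAlgebraicSet W ∧ W ⊆ X) Z

/-- The dimension of an irreducible algebraic set: the transcendence degree over `ℂ` of its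
coordinate ring. -/
def dimension (Z : Set Param) : Cardinal :=
  Algebra.trdeg ℂ (MvPolynomial (Fin 6 ⊕ Fin 4) ℂ ⧸ vanishingIdeal ℂ Z)

/-! ### Exponents -/

/-- Reordering the four exponents; the operator itself does not change. -/
def permuteExponents (τ : Equiv.Perm (Fin 4)) (p : Param) : Param :=
  fun i => p (Sum.map id τ i)

/-- `σ = (α + β + γ + δ) / 2`, twice the average exponent at infinity. -/
def sigma (p : Param) : ℂ :=
  (∑ i : Fin 4, p (.inr i)) / 2

/-- The parameters of the operators
`θ⁴ + x(aθ⁴ + 2aθ³ + (a + d)θ² + dθ + e) + f x²(θ + α)(θ + β)(θ + 2 - α)(θ + 2 - β)`. -/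
def mainFamily : Set Param :=
  {p | ∃ a d e f α β : ℂ,
    p = Sum.elim ![a, 2 * a, a + d, d, e, f] ![α, β, 2 - α, 2 - β]}

end CYDegreeTwo

end

/-!
Write the operator in monic `θ`-form `θ⁴ + A₃θ³ + A₂θ² + A₁θ + A₀`. Then
`x³𝒬 = ½A₂A₃ - A₁ - ⅛A₃³ + θA₂ - ¾A₃θA₃ - ½θ²A₃`, so `8(1 + ax + fx²)³x³𝒬` is a polynomial and `X`
is cut out by its six coefficients.

To solve these equations, look at the poles of `𝒬`. At a simple root of `1 + ax + fx²` the leading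
term forces the normalized residue `r` of `A₃` to be `0`, `2` or `4`, and unless `r = 2` the next
term determines the residue of `A₂`. If `f ≠ 0`, the top coefficient forces the exponents to pair up
with equal sums, and `2σ` is the sum of the two residues: two simple roots give the six families of
constant `σ`, a double root gives the transverse family or a member of the main one. If `f = 0`,
the possible values of `r` give the three degenerate families.

Each family is the image of an affine space under a polynomial map with a polynomial retraction,
hence closed and irreducible of the evident dimension; explicit points show that no family is
contained in a permuted copy of another.
-/

noncomputable section

namespace CYDegreeTwo

section AlgebraicSets

open MvPolynomial

theorem zeroLocus_mul {σ k K : Type*} [Field k] [Field K] [Algebra k K]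
    (I J : Ideal (MvPolynomial σ k)) :
    zeroLocus K (I * J) = zeroLocus K I ∪ zeroLocus K J := by
  refine Set.Subset.antisymm (fun x hx => ?_) (Set.union_subset
    (zeroLocus_anti_mono Ideal.mul_le_left) (zeroLocus_anti_mono Ideal.mul_le_right))
  by_contra! hc
  simp only [Set.mem_union, mem_zeroLocus_iff, not_or, not_forall] at hc
  obtain ⟨⟨g, hg, hgx⟩, h, hh, hhx⟩ := hc
  have hgh := hx (g * h) (Ideal.mul_mem_mul hg hh)
  rw [map_mul] at hgh
  exact mul_ne_zero hgx hhx hgh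

theorem isAlgebraicSet_empty : IsAlgebraicSet ∅ :=
  ⟨⊤, by simp⟩

theorem IsAlgebraicSet.union {Z₁ Z₂ : Set Param} (h₁ : IsAlgebraicSet Z₁)
    (h₂ : IsAlgebraicSet Z₂) : IsAlgebraicSet (Z₁ ∪ Z₂) := by
  obtain ⟨I, rfl⟩ := h₁
  obtain ⟨J, rfl⟩ := h₂
  exact ⟨I * J, (zeroLocus_mul I J).symm⟩

theorem isAlgebraicSet_sUnion {S : Set (Set Param)} (hS : S.Finite)
    (h : ∀ Z ∈ S, IsAlgebraicSet Z) : IsAlgebraicSet (⋃₀ S) := by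
  induction S, hS using Set.Finite.induction_on with
  | empty => simpa only [Set.sUnion_empty] using isAlgebraicSet_empty
  | insert _ _ ih =>
    rw [Set.sUnion_insert]
    exact (h _ (Set.mem_insert _ _)).union (ih fun Z hZ => h Z (Set.mem_insert_of_mem _ hZ))

theorem IsAlgebraicSet.isIrreducibleAlgebraicSet {Z : Set Param} (hZ : IsAlgebraicSet Z)
    (hne : Z.Nonempty) (hprime : (vanishingIdeal ℂ Z).IsPrime) : IsIrreducibleAlgebraicSet Z := by
  refine ⟨hZ, hne, ?_⟩
  rintro _ _ ⟨I, rfl⟩ ⟨J, rfl⟩ h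
  rw [← zeroLocus_mul] at h
  simpa only [le_zeroLocus_iff_le_vanishingIdeal, hprime.mul_le] using h

theorem IsIrreducibleAlgebraicSet.exists_subset_of_subset_sUnion {W : Set Param}
    (hW : IsIrreducibleAlgebraicSet W) {S : Set (Set Param)} (hS : S.Finite)
    (h : ∀ Z ∈ S, IsAlgebraicSet Z) (hWS : W ⊆ ⋃₀ S) : ∃ Z ∈ S, W ⊆ Z := by
  induction S, hS using Set.Finite.induction_on with
  | empty =>
    rw [Set.sUnion_empty, Set.subset_empty_iff] at hWS
    exact absurd hWS hW.2.1.ne_empty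
  | insert _ hfin ih =>
    rw [Set.forall_mem_insert] at h
    rw [Set.sUnion_insert] at hWS
    rw [Set.exists_mem_insert]
    exact (hW.2.2 _ _ h.1 (isAlgebraicSet_sUnion hfin h.2) hWS).imp_right (ih h.2)

theorem setOf_isComponent_sUnion {S : Set (Set Param)} (hS : S.Finite)
    (hirr : ∀ Z ∈ S, IsIrreducibleAlgebraicSet Z) (hanti : IsAntichain (· ⊆ ·) S) :
    {Z | IsComponent (⋃₀ S) Z} = S := by
  have hcover {W : Set Param} (hW : IsIrreducibleAlgebraicSet W ∧ W ⊆ ⋃₀ S) : ∃ Z ∈ S, W ⊆ Z :=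
    hW.1.exists_subset_of_subset_sUnion hS (fun Z hZ => (hirr Z hZ).1) hW.2
  ext W
  constructor
  · intro hW
    obtain ⟨Z, hZ, hWZ⟩ := hcover hW.1
    rwa [hWZ.antisymm (hW.2 ⟨hirr Z hZ, Set.subset_sUnion_of_mem hZ⟩ hWZ)]
  · refine fun hW => ⟨⟨hirr W hW, Set.subset_sUnion_of_mem hW⟩, fun V hV hWV => ?_⟩
    obtain ⟨Z, hZ, hVZ⟩ := hcover hV
    rwa [hanti.eq hW hZ (hWV.trans hVZ)]

end AlgebraicSets

/-- A closed embedding of affine `ι`-space into affine `σ`-space over `k` with a polynomial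
retraction, both given by their coordinate polynomials. -/
structure PolyEmbedding (k σ ι : Type*) [CommRing k] where
  /-- The coordinates of the embedding. -/
  coord : σ → MvPolynomial ι k
  /-- The coordinates of the retraction. -/
  retract : ι → MvPolynomial σ k
  aeval_retract : ∀ j, MvPolynomial.aeval coord (retract j) = MvPolynomial.X j

namespace PolyEmbedding

open MvPolynomial

section CommRing

variable {k σ σ' ι : Type*} [CommRing k] (c : PolyEmbedding k σ ι)

/-- The point of affine `σ`-space with parameters `t`. -/
def point (t : ι → k) : σ → k := fun i => aeval t (c.coord i)

/-- The image of the embedding. -/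
def range : Set (σ → k) := Set.range c.point

theorem aeval_point (t : ι → k) (g : MvPolynomial σ k) :
    aeval (c.point t) g = aeval t (aeval c.coord g) :=
  (comp_aeval_apply c.coord (aeval t) g).symm

theorem mem_range_iff {p : σ → k} :
    p ∈ c.range ↔ ∀ i, p i = aeval (fun j => aeval p (c.retract j)) (c.coord i) := by
  refine ⟨?_, fun h => ⟨_, (funext h).symm⟩⟩
  rintro ⟨t, rfl⟩ i
  simp only [aeval_point, c.aeval_retract, aeval_X]
  rfl

theorem aeval_coord_surjective : Function.Surjective (aeval c.coord : _ →ₐ[k] MvPolynomial ι k) :=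
  fun g => ⟨aeval c.retract g, by
    rw [comp_aeval_apply, funext c.aeval_retract, aeval_X_left_apply]⟩

/-- The embedding followed by the relabelling of coordinates along `e`. -/
def reindex (e : σ' ≃ σ) : PolyEmbedding k σ' ι where
  coord := c.coord ∘ e
  retract j := rename e.symm (c.retract j)
  aeval_retract j := by
    rw [aeval_rename, Function.comp_assoc, e.self_comp_symm, Function.comp_id, c.aeval_retract]

theorem range_reindex (e : σ' ≃ σ) : (c.reindex e).range = (· ∘ e) '' c.range :=
  Set.range_comp (· ∘ e) c.point

end CommRing

section Field

universe u v

variable {k : Type u} {σ ι : Type v} [Field k] (c : PolyEmbedding k σ ι)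

theorem range_eq_zeroLocus :
    c.range = zeroLocus k
      (Ideal.span (Set.range fun i => X i - aeval c.retract (c.coord i))) := by
  ext p
  simp only [mem_range_iff, zeroLocus_span, Set.forall_mem_range, Set.mem_ofPred_eq, map_sub,
    aeval_X, comp_aeval_apply, sub_eq_zero]

variable [Infinite k]

theorem vanishingIdeal_range :
    vanishingIdeal k c.range = RingHom.ker (aeval c.coord : _ →ₐ[k] MvPolynomial ι k) := by
  ext g
  rw [mem_vanishingIdeal_iff, RingHom.mem_ker, MvPolynomial.funext_iff]
  simp only [range, Set.forall_mem_range, aeval_point, map_zero, ← aeval_eq_eval]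

theorem isPrime_vanishingIdeal_range : (vanishingIdeal k c.range).IsPrime := by
  rw [vanishingIdeal_range]
  exact RingHom.ker_isPrime _

theorem trdeg_quotient_vanishingIdeal_range :
    Algebra.trdeg k (MvPolynomial σ k ⧸ vanishingIdeal k c.range) =
      Cardinal.lift.{u} (Cardinal.mk ι) := by
  rw [vanishingIdeal_range,
    (Ideal.quotientKerAlgEquivOfSurjective c.aeval_coord_surjective).trdeg_eq,
    MvPolynomial.trdeg_of_isDomain]

end Field

variable {ι : Type}

theorem isIrreducibleAlgebraicSet_range (c : PolyEmbedding ℂ (Fin 6 ⊕ Fin 4) ι) :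
    IsIrreducibleAlgebraicSet c.range :=
  IsAlgebraicSet.isIrreducibleAlgebraicSet ⟨_, c.range_eq_zeroLocus⟩ (Set.range_nonempty _)
    c.isPrime_vanishingIdeal_range

theorem dimension_range (c : PolyEmbedding ℂ (Fin 6 ⊕ Fin 4) ι) :
    dimension c.range = Cardinal.mk ι := by
  rw [dimension, trdeg_quotient_vanishingIdeal_range, Cardinal.lift_id]

end PolyEmbedding

section Permutations

variable {τ ρ : Equiv.Perm (Fin 4)} {Z : Set Param} {p : Param}

theorem permuteExponents_permuteExponents (τ ρ : Equiv.Perm (Fin 4)) (p : Param) :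
    permuteExponents τ (permuteExponents ρ p) = permuteExponents (ρ * τ) p := by
  ext (i | i) <;> rfl

theorem permuteExponents_one (p : Param) : permuteExponents 1 p = p := by
  ext (i | i) <;> rfl

theorem mem_image_permuteExponents :
    p ∈ permuteExponents τ '' Z ↔ permuteExponents τ⁻¹ p ∈ Z := by
  have hleft : Function.LeftInverse (permuteExponents τ⁻¹) (permuteExponents τ) := fun q => by
    rw [permuteExponents_permuteExponents, mul_inv_cancel, permuteExponents_one]
  have hright : Function.RightInverse (permuteExponents τ⁻¹) (permuteExponents τ) := fun q => by
    rw [permuteExponents_permuteExponents, inv_mul_cancel, permuteExponents_one]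
  rw [Set.image_eq_preimage_of_inverse hleft hright, Set.mem_preimage]

theorem permuteExponents_image_eq_of_subset
    (h : permuteExponents τ '' Z ⊆ permuteExponents ρ '' Z) :
    permuteExponents τ '' Z = permuteExponents ρ '' Z := by
  have hmaps : Set.MapsTo (permuteExponents (τ * ρ⁻¹)) Z Z := fun p hp => by
    simpa only [mem_image_permuteExponents, permuteExponents_permuteExponents]
      using h (Set.mem_image_of_mem _ hp)
  have hpow (n : ℕ) : permuteExponents ((τ * ρ⁻¹) ^ n) = (permuteExponents (τ * ρ⁻¹))^[n] := by
    induction n with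
    | zero => exact funext permuteExponents_one
    | succ n ih =>
      rw [Function.iterate_succ', ← ih, pow_succ]
      exact funext fun p => (permuteExponents_permuteExponents _ _ p).symm
  -- The inverse of an element of finite order is one of its powers.
  obtain ⟨n, hn : (τ * ρ⁻¹) ^ n = (τ * ρ⁻¹)⁻¹⟩ :=
    mem_powers_iff_mem_zpowers.mpr (inv_mem (Subgroup.mem_zpowers (τ * ρ⁻¹)))
  refine h.antisymm ?_
  rintro _ ⟨p, hp, rfl⟩
  rw [mem_image_permuteExponents, permuteExponents_permuteExponents,
    show ρ * τ⁻¹ = (τ * ρ⁻¹) ^ n by rw [hn, mul_inv_rev, inv_inv], hpow]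
  exact hmaps.iterate n hp

theorem sigma_permuteExponents (τ : Equiv.Perm (Fin 4)) (p : Param) :
    sigma (permuteExponents τ p) = sigma p :=
  congrArg (· / 2) (Equiv.sum_comp τ fun i => p (.inr i))

theorem isIrreducibleAlgebraicSet_permuteExponents_image {ι : Type}
    (c : PolyEmbedding ℂ (Fin 6 ⊕ Fin 4) ι) (τ : Equiv.Perm (Fin 4)) :
    IsIrreducibleAlgebraicSet (permuteExponents τ '' c.range) :=
  c.range_reindex (.sumCongr (.refl _) τ) ▸
    (c.reindex (.sumCongr (.refl _) τ)).isIrreducibleAlgebraicSet_range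

end Permutations

section EulerOperator

open Filter Topology

variable {𝕜 : Type*} [NontriviallyNormedField 𝕜]

/-- The Euler operator `θ = x d/dx`. -/
def eulerDeriv (g : 𝕜 → 𝕜) (x : 𝕜) : 𝕜 := x * deriv g x

theorem eulerDeriv_congr {g h : 𝕜 → 𝕜} {x : 𝕜} (hgh : g =ᶠ[𝓝 x] h) :
    eulerDeriv g x = eulerDeriv h x :=
  congrArg (x * ·) hgh.deriv_eq

theorem eulerDeriv_add {g h : 𝕜 → 𝕜} {x : 𝕜} (hg : DifferentiableAt 𝕜 g x)
    (hh : DifferentiableAt 𝕜 h x) :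
    eulerDeriv (g + h) x = eulerDeriv g x + eulerDeriv h x := by
  rw [eulerDeriv, deriv_add hg hh, mul_add, eulerDeriv, eulerDeriv]

theorem eulerDeriv_mul {g h : 𝕜 → 𝕜} {x : 𝕜} (hg : DifferentiableAt 𝕜 g x)
    (hh : DifferentiableAt 𝕜 h x) :
    eulerDeriv (g * h) x = eulerDeriv g x * h x + g x * eulerDeriv h x := by
  rw [eulerDeriv, deriv_mul hg hh, eulerDeriv, eulerDeriv]
  ring

-- The summand `0` lets this be iterated.
theorem eulerDeriv_quadratic (k l m : 𝕜) :
    eulerDeriv (fun x => k + x * l + x ^ 2 * m) = fun x => 0 + x * l + x ^ 2 * (2 * m) := by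
  ext x
  have hderiv : HasDerivAt (fun x : 𝕜 => k + x * l + x ^ 2 * m) (l + 2 * x * m) x := by
    simpa using (((hasDerivAt_id x).mul_const l).const_add k).fun_add
      (((hasDerivAt_id x).pow 2).mul_const m)
  rw [eulerDeriv, hderiv.deriv]
  ring

theorem deriv_div_pow {g : 𝕜 → 𝕜} {x : 𝕜} (hg : DifferentiableAt 𝕜 g x) (hx : x ≠ 0) (n : ℕ) :
    deriv (fun y => g y / y ^ n) x = (eulerDeriv g x - n * g x) / x ^ (n + 1) := by
  rw [deriv_fun_div hg (differentiableAt_pow n) (pow_ne_zero n hx), deriv_pow_field, eulerDeriv]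
  rcases n with _ | n
  · simp [hx]
  · rw [Nat.add_sub_cancel]
    field_simp
    ring

theorem analyticAt_eulerDeriv [CompleteSpace 𝕜] {g : 𝕜 → 𝕜} {x : 𝕜} (hg : AnalyticAt 𝕜 g x) :
    AnalyticAt 𝕜 (eulerDeriv g) x :=
  analyticAt_id.mul hg.deriv

theorem eulerDeriv_eulerDeriv_mul [CompleteSpace 𝕜] {g h : 𝕜 → 𝕜} {x : 𝕜}
    (hg : AnalyticAt 𝕜 g x) (hh : AnalyticAt 𝕜 h x) :
    eulerDeriv (eulerDeriv (g * h)) x = eulerDeriv (eulerDeriv g) x * h x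
      + 2 * (eulerDeriv g x * eulerDeriv h x) + g x * eulerDeriv (eulerDeriv h) x := by
  have hθg := analyticAt_eulerDeriv hg
  have hθh := analyticAt_eulerDeriv hh
  have hleibniz : eulerDeriv (g * h) =ᶠ[𝓝 x] eulerDeriv g * h + g * eulerDeriv h := by
    filter_upwards [hg.eventually_analyticAt, hh.eventually_analyticAt] with y hgy hhy
    exact eulerDeriv_mul hgy.differentiableAt hhy.differentiableAt
  rw [eulerDeriv_congr hleibniz,
    eulerDeriv_add (hθg.mul hh).differentiableAt (hg.mul hθh).differentiableAt,
    eulerDeriv_mul hθg.differentiableAt hh.differentiableAt,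
    eulerDeriv_mul hg.differentiableAt hθh.differentiableAt]
  ring

end EulerOperator

section NormalForm

open Filter Topology

variable (p : Param) {x : ℂ}

theorem derivCoeff_four (x : ℂ) : derivCoeff p 4 x = x ^ 4 * thetaCoeff p 4 x := by
  simp [derivCoeff, Finset.sum_range_succ, Nat.stirlingSecond]

theorem derivCoeff_four_ne_zero_iff : derivCoeff p 4 x ≠ 0 ↔ x ≠ 0 ∧ thetaCoeff p 4 x ≠ 0 := by
  rw [derivCoeff_four, mul_ne_zero_iff, pow_ne_zero_iff four_ne_zero]

/-- The coefficient `Aₖ` of `θᵏ` in the monic `θ`-form `θ⁴ + A₃θ³ + A₂θ² + A₁θ + A₀` of the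
operator. -/
def monicThetaCoeff (k : ℕ) (x : ℂ) : ℂ := thetaCoeff p k x / thetaCoeff p 4 x

theorem analyticAt_thetaCoeff (k : ℕ) (x : ℂ) : AnalyticAt ℂ (thetaCoeff p k) x := by
  unfold thetaCoeff
  fun_prop

variable {p}

theorem analyticAt_monicThetaCoeff (hD : thetaCoeff p 4 x ≠ 0) (k : ℕ) :
    AnalyticAt ℂ (monicThetaCoeff p k) x :=
  (analyticAt_thetaCoeff p k x).div (analyticAt_thetaCoeff p 4 x) hD

theorem eventually_ne_zero_and_thetaCoeff_four_ne_zero (hx : x ≠ 0)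
    (hD : thetaCoeff p 4 x ≠ 0) : ∀ᶠ y in 𝓝 x, y ≠ 0 ∧ thetaCoeff p 4 y ≠ 0 :=
  (eventually_ne_nhds hx).and ((analyticAt_thetaCoeff p 4 x).continuousAt.eventually_ne hD)

theorem monicThetaCoeff_four (hD : thetaCoeff p 4 x ≠ 0) : monicThetaCoeff p 4 x = 1 :=
  div_self hD

theorem monicCoeff_eq_sum_stirlingSecond {j : ℕ} (hj : j ≤ 4) (hx : x ≠ 0) :
    monicCoeff p j x =
      (∑ k ∈ Finset.range 5, (Nat.stirlingSecond k j : ℂ) * monicThetaCoeff p k x)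
        / x ^ (4 - j) := by
  simp only [monicThetaCoeff, mul_div_assoc', ← Finset.sum_div]
  rw [monicCoeff, derivCoeff_four, derivCoeff, ← pow_mul_pow_sub x hj, mul_assoc,
    mul_div_mul_left _ _ (pow_ne_zero j hx), mul_comm (x ^ _), div_div]

theorem monicCoeff_three (hx : x ≠ 0) (hD : thetaCoeff p 4 x ≠ 0) :
    monicCoeff p 3 x = (monicThetaCoeff p 3 x + 6) / x ^ 1 := by
  simp [monicCoeff_eq_sum_stirlingSecond, hx, Finset.sum_range_succ, Nat.stirlingSecond,
    monicThetaCoeff_four hD]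

theorem monicCoeff_two (hx : x ≠ 0) (hD : thetaCoeff p 4 x ≠ 0) :
    monicCoeff p 2 x = (monicThetaCoeff p 2 x + 3 * monicThetaCoeff p 3 x + 7) / x ^ 2 := by
  simp [monicCoeff_eq_sum_stirlingSecond, hx, Finset.sum_range_succ, Nat.stirlingSecond,
    monicThetaCoeff_four hD]

theorem monicCoeff_one (hx : x ≠ 0) (hD : thetaCoeff p 4 x ≠ 0) :
    monicCoeff p 1 x =
      (monicThetaCoeff p 1 x + monicThetaCoeff p 2 x + monicThetaCoeff p 3 x + 1) / x ^ 3 := by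
  simp [monicCoeff_eq_sum_stirlingSecond, hx, Finset.sum_range_succ, Nat.stirlingSecond,
    monicThetaCoeff_four hD]

theorem deriv_monicCoeff_two (hx : x ≠ 0) (hD : thetaCoeff p 4 x ≠ 0) :
    deriv (monicCoeff p 2) x =
      (eulerDeriv (monicThetaCoeff p 2) x + 3 * eulerDeriv (monicThetaCoeff p 3) x
        - 2 * (monicThetaCoeff p 2 x + 3 * monicThetaCoeff p 3 x + 7)) / x ^ 3 := by
  have hmonic : monicCoeff p 2 =ᶠ[𝓝 x]
      fun y => (monicThetaCoeff p 2 y + 3 * monicThetaCoeff p 3 y + 7) / y ^ 2 :=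
    (eventually_ne_zero_and_thetaCoeff_four_ne_zero hx hD).mono fun y hy =>
      monicCoeff_two hy.1 hy.2
  have hA₂ := (analyticAt_monicThetaCoeff hD 2).differentiableAt
  have hA₃ := (analyticAt_monicThetaCoeff hD 3).differentiableAt
  rw [hmonic.deriv_eq, deriv_div_pow (by fun_prop) hx]
  simp only [eulerDeriv, hA₂, DifferentiableAt.fun_add_iff_right, differentiableAt_const, hA₃,
    DifferentiableAt.fun_mul, deriv_fun_add, deriv_fun_mul, deriv_const', zero_mul, zero_add,
    add_zero, Nat.cast_ofNat, Nat.reduceAdd]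
  ring

theorem deriv_monicCoeff_three (hx : x ≠ 0) (hD : thetaCoeff p 4 x ≠ 0) :
    deriv (monicCoeff p 3) x =
      (eulerDeriv (monicThetaCoeff p 3) x - (monicThetaCoeff p 3 x + 6)) / x ^ 2 := by
  have hmonic : monicCoeff p 3 =ᶠ[𝓝 x] fun y => (monicThetaCoeff p 3 y + 6) / y ^ 1 :=
    (eventually_ne_zero_and_thetaCoeff_four_ne_zero hx hD).mono fun y hy =>
      monicCoeff_three hy.1 hy.2
  have hA₃ := (analyticAt_monicThetaCoeff hD 3).differentiableAt
  rw [hmonic.deriv_eq, deriv_div_pow (by fun_prop) hx]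
  simp [eulerDeriv]

theorem deriv_deriv_monicCoeff_three (hx : x ≠ 0) (hD : thetaCoeff p 4 x ≠ 0) :
    deriv (deriv (monicCoeff p 3)) x =
      (eulerDeriv (eulerDeriv (monicThetaCoeff p 3)) x - 3 * eulerDeriv (monicThetaCoeff p 3) x
        + 2 * (monicThetaCoeff p 3 x + 6)) / x ^ 3 := by
  have hderiv : deriv (monicCoeff p 3) =ᶠ[𝓝 x]
      fun y => (eulerDeriv (monicThetaCoeff p 3) y - (monicThetaCoeff p 3 y + 6)) / y ^ 2 :=
    (eventually_ne_zero_and_thetaCoeff_four_ne_zero hx hD).mono fun y hy =>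
      deriv_monicCoeff_three hy.1 hy.2
  have hA₃ := (analyticAt_monicThetaCoeff hD 3).differentiableAt
  have hθA₃ := (analyticAt_eulerDeriv (analyticAt_monicThetaCoeff hD 3)).differentiableAt
  rw [hderiv.deriv_eq, deriv_div_pow (by fun_prop) hx]
  congr 1
  conv_lhs => rw [eulerDeriv, deriv_fun_sub hθA₃ (by fun_prop), deriv_add_const, mul_sub]
  simp only [eulerDeriv]
  ring

theorem cube_mul_calQ (hx : x ≠ 0) (hD : thetaCoeff p 4 x ≠ 0) :
    x ^ 3 * calQ p x =
      1 / 2 * monicThetaCoeff p 2 x * monicThetaCoeff p 3 x - monicThetaCoeff p 1 x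
        - 1 / 8 * monicThetaCoeff p 3 x ^ 3 + eulerDeriv (monicThetaCoeff p 2) x
        - 3 / 4 * monicThetaCoeff p 3 x * eulerDeriv (monicThetaCoeff p 3) x
        - 1 / 2 * eulerDeriv (eulerDeriv (monicThetaCoeff p 3)) x := by
  rw [calQ, monicCoeff_one hx hD, monicCoeff_two hx hD, monicCoeff_three hx hD,
    deriv_monicCoeff_two hx hD, deriv_monicCoeff_three hx hD, deriv_deriv_monicCoeff_three hx hD]
  field_simp
  ring

end NormalForm

section Equations

/-- The first elementary symmetric function of the exponents. -/
def esymmOne (p : Param) : ℂ := p (.inr 0) + p (.inr 1) + p (.inr 2) + p (.inr 3)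

/-- The second elementary symmetric function of the exponents. -/
def esymmTwo (p : Param) : ℂ :=
  p (.inr 0) * p (.inr 1) + p (.inr 0) * p (.inr 2) + p (.inr 0) * p (.inr 3)
    + p (.inr 1) * p (.inr 2) + p (.inr 1) * p (.inr 3) + p (.inr 2) * p (.inr 3)

/-- The third elementary symmetric function of the exponents. -/
def esymmThree (p : Param) : ℂ :=
  p (.inr 0) * p (.inr 1) * p (.inr 2) + p (.inr 0) * p (.inr 1) * p (.inr 3)
    + p (.inr 0) * p (.inr 2) * p (.inr 3) + p (.inr 1) * p (.inr 2) * p (.inr 3)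

/-- The coefficients of `x, …, x⁶` in `8 (1 + a x + f x²)³ x³ 𝒬`, in terms of the coefficients of
the operator and the elementary symmetric functions `s₁, s₂, s₃` of the exponents. -/
def numeratorCoeff (a b c d f s₁ s₂ s₃ : ℂ) : Fin 6 → ℂ :=
  ![8*c - 4*b - 8*d,
    4*a*b + 8*a*c - 16*a*d + 4*b*c - 6*b^2 + f*(16*s₂ - 8*s₃ - 16*s₁),
    4*a*b*c - b^3 - 8*a^2*d + f*(a*(24*s₂ - 12*s₁ - 16*s₃) + b*(24 + 4*s₂ - 18*s₁)
      + 4*c*s₁ - 16*d),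
    f*(a^2*(8*s₂ - 8*s₃ - 4*s₁) + a*b*(4 + 4*s₂ - 6*s₁) + a*c*(4*s₁ - 8) - 16*a*d
      + 4*b*c + b^2*(6 - 3*s₁)) + f^2*(16*s₂ - 16*s₃ + 16*s₁ + 4*s₁*s₂ - 12*s₁^2),
    f^2*(a*(8*s₂ - 16*s₃ + 4*s₁ + 4*s₁*s₂ - 6*s₁^2) + b*(4*s₂ - 4 + 6*s₁ - 3*s₁^2)
      + c*(4*s₁ - 8) - 8*d),
    f^3*(4*s₁*s₂ - 8*s₃ - s₁^3)]

/-- The six polynomial equations cutting out `X`. -/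
def cyEquation (p : Param) : Fin 6 → ℂ :=
  numeratorCoeff (p (.inl 0)) (p (.inl 1)) (p (.inl 2)) (p (.inl 3)) (p (.inl 5))
    (esymmOne p) (esymmTwo p) (esymmThree p)

variable (p : Param) {x : ℂ}

open Polynomial in
theorem P₂_eq :
    P₂ p = C (p (.inl 5)) * X ^ 4 + C (p (.inl 5) * esymmOne p) * X ^ 3
      + C (p (.inl 5) * esymmTwo p) * X ^ 2 + C (p (.inl 5) * esymmThree p) * X
      + C (p (.inl 5) * (p (.inr 0) * p (.inr 1) * p (.inr 2) * p (.inr 3))) := by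
  simp only [P₂, Fin.prod_univ_four, esymmOne, esymmTwo, esymmThree, map_mul, map_add]
  ring

theorem thetaCoeff_four (x : ℂ) :
    thetaCoeff p 4 x = 1 + x * p (.inl 0) + x ^ 2 * p (.inl 5) := by
  simp [thetaCoeff, P₀, P₁, P₂_eq, -map_mul]

variable {p}

theorem eventuallyEq_thetaCoeff (hD : thetaCoeff p 4 x ≠ 0) (k : ℕ) :
    thetaCoeff p k =ᶠ[nhds x] monicThetaCoeff p k * thetaCoeff p 4 :=
  ((analyticAt_thetaCoeff p 4 x).continuousAt.eventually_ne hD).mono fun _ hy =>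
    (div_mul_cancel₀ _ hy).symm

theorem eulerDeriv_thetaCoeff (hD : thetaCoeff p 4 x ≠ 0) (k : ℕ) :
    eulerDeriv (thetaCoeff p k) x = eulerDeriv (monicThetaCoeff p k) x * thetaCoeff p 4 x
      + monicThetaCoeff p k x * eulerDeriv (thetaCoeff p 4) x := by
  rw [eulerDeriv_congr (eventuallyEq_thetaCoeff hD k),
    eulerDeriv_mul (analyticAt_monicThetaCoeff hD k).differentiableAt
      (analyticAt_thetaCoeff p 4 x).differentiableAt]

theorem eulerDeriv_eulerDeriv_thetaCoeff (hD : thetaCoeff p 4 x ≠ 0) (k : ℕ) :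
    eulerDeriv (eulerDeriv (thetaCoeff p k)) x =
      eulerDeriv (eulerDeriv (monicThetaCoeff p k)) x * thetaCoeff p 4 x
      + 2 * (eulerDeriv (monicThetaCoeff p k) x * eulerDeriv (thetaCoeff p 4) x)
      + monicThetaCoeff p k x * eulerDeriv (eulerDeriv (thetaCoeff p 4)) x := by
  rw [← eulerDeriv_eulerDeriv_mul (analyticAt_monicThetaCoeff hD k) (analyticAt_thetaCoeff p 4 x)]
  exact eulerDeriv_congr <| (eventuallyEq_thetaCoeff hD k).eventuallyEq_nhds.mono
    fun _ hy => eulerDeriv_congr hy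

theorem calQ_mul_eq_sum_cyEquation (hx : x ≠ 0) (hD : thetaCoeff p 4 x ≠ 0) :
    8 * thetaCoeff p 4 x ^ 3 * (x ^ 3 * calQ p x) = ∑ j, cyEquation p j * x ^ (j + 1 : ℕ) := by
  have hclear : 8 * thetaCoeff p 4 x ^ 3 * (x ^ 3 * calQ p x) =
      4 * thetaCoeff p 4 x * thetaCoeff p 3 x * thetaCoeff p 2 x
      - 8 * thetaCoeff p 4 x ^ 2 * thetaCoeff p 1 x - thetaCoeff p 3 x ^ 3
      + 8 * thetaCoeff p 4 x * (thetaCoeff p 4 x * eulerDeriv (thetaCoeff p 2) x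
        - thetaCoeff p 2 x * eulerDeriv (thetaCoeff p 4) x)
      + (8 * eulerDeriv (thetaCoeff p 4) x - 6 * thetaCoeff p 3 x)
        * (thetaCoeff p 4 x * eulerDeriv (thetaCoeff p 3) x
          - thetaCoeff p 3 x * eulerDeriv (thetaCoeff p 4) x)
      - 4 * thetaCoeff p 4 x * (thetaCoeff p 4 x * eulerDeriv (eulerDeriv (thetaCoeff p 3)) x
        - thetaCoeff p 3 x * eulerDeriv (eulerDeriv (thetaCoeff p 4)) x) := by
    rw [cube_mul_calQ hx hD, eulerDeriv_thetaCoeff hD 2, eulerDeriv_thetaCoeff hD 3,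
      eulerDeriv_eulerDeriv_thetaCoeff hD 3, (eventuallyEq_thetaCoeff hD 1).eq_of_nhds,
      (eventuallyEq_thetaCoeff hD 2).eq_of_nhds, (eventuallyEq_thetaCoeff hD 3).eq_of_nhds]
    simp only [Pi.mul_apply]
    ring
  have hquadratic (k : ℕ) : thetaCoeff p k =
      fun y => P₀.coeff k + y * (P₁ p).coeff k + y ^ 2 * (P₂ p).coeff k := rfl
  rw [hclear]
  simp only [hquadratic, eulerDeriv_quadratic]
  simp only [P₀, P₁, P₂_eq, cyEquation, numeratorCoeff, Polynomial.coeff_X_pow,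
    Polynomial.coeff_add, Polynomial.coeff_C_mul, Polynomial.coeff_mul_X, Polynomial.coeff_C_succ,
    Polynomial.coeff_C, ↓reduceIte, Fin.isValue, mul_one, Nat.succ_ne_self, mul_zero, add_zero,
    zero_add, Nat.reduceEqDiff, OfNat.one_ne_ofNat, Fin.sum_univ_six, Matrix.cons_val_zero,
    Fin.coe_ofNat_eq_mod, Nat.zero_mod, pow_one, Matrix.cons_val_one, Nat.one_mod, Nat.reduceAdd,
    Matrix.cons_val, Nat.reduceMod, Nat.mod_succ]
  ring

open Polynomial in
theorem mem_cySet_iff : p ∈ cySet ↔ ∀ j, cyEquation p j = 0 := by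
  simp only [cySet, Set.mem_ofPred_eq, derivCoeff_four_ne_zero_iff, and_imp]
  constructor
  · intro h
    have hprod : (∑ j, C (cyEquation p j) * X ^ (j + 1 : ℕ)) *
        (X * (1 + X * C (p (.inl 0)) + X ^ 2 * C (p (.inl 5)))) = 0 := by
      refine Polynomial.funext fun x => ?_
      simp only [eval_mul, eval_finsetSum, eval_C, eval_pow, eval_X, eval_add, eval_one,
        eval_zero, ← thetaCoeff_four]
      by_cases hx : x = 0
      · simp [hx]
      by_cases hD : thetaCoeff p 4 x = 0
      · simp [hD]
      rw [← calQ_mul_eq_sum_cyEquation hx hD, h x hx hD]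
      ring
    have hD : (1 + X * C (p (.inl 0)) + X ^ 2 * C (p (.inl 5)) : ℂ[X]) ≠ 0 := fun h0 => by
      simpa using congrArg (eval 0) h0
    have hsum := (mul_eq_zero.mp hprod).resolve_right (mul_ne_zero X_ne_zero hD)
    intro j
    simpa [coeff_X_pow, Fin.val_inj, finsetSum_coeff, Finset.sum_ite_eq] using
      congrArg (fun q => coeff q (j + 1)) hsum
  · intro h x hx hD
    have hzero := calQ_mul_eq_sum_cyEquation hx hD
    simp only [h, zero_mul, Finset.sum_const_zero] at hzero
    simpa [hx, hD] using hzero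

theorem P₂_permuteExponents (τ : Equiv.Perm (Fin 4)) (p : Param) :
    P₂ (permuteExponents τ p) = P₂ p :=
  congrArg (_ * ·) (Equiv.prod_comp τ fun i => Polynomial.X + Polynomial.C (p (.inr i)))

theorem thetaCoeff_permuteExponents (τ : Equiv.Perm (Fin 4)) (p : Param) :
    thetaCoeff (permuteExponents τ p) = thetaCoeff p := by
  ext k x
  rw [thetaCoeff, P₂_permuteExponents]
  rfl

theorem permuteExponents_mem_cySet_iff {τ : Equiv.Perm (Fin 4)} :
    permuteExponents τ p ∈ cySet ↔ p ∈ cySet := by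
  have hderiv : derivCoeff (permuteExponents τ p) = derivCoeff p := by
    unfold derivCoeff
    rw [thetaCoeff_permuteExponents]
  have hmonic : monicCoeff (permuteExponents τ p) = monicCoeff p := by
    unfold monicCoeff
    rw [hderiv]
  simp only [cySet, Set.mem_ofPred_eq, calQ, hderiv, hmonic]

end Equations

section Families

open MvPolynomial Complex

/-- The operators with `b = c = d = f = 0`. -/
def degenerateZero : PolyEmbedding ℂ (Fin 6 ⊕ Fin 4) (Fin 6) where
  coord := Sum.elim ![X 0, 0, 0, 0, X 1, 0] ![X 2, X 3, X 4, X 5]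
  retract := ![X (.inl 0), X (.inl 4), X (.inr 0), X (.inr 1), X (.inr 2), X (.inr 3)]
  aeval_retract j := by fin_cases j <;> simp

/-- The operators with `b = 2a`, `c = a + d`, `f = 0`. -/
def degenerateTwo : PolyEmbedding ℂ (Fin 6 ⊕ Fin 4) (Fin 7) where
  coord := Sum.elim ![X 0, 2 * X 0, X 0 + X 1, X 1, X 2, 0] ![X 3, X 4, X 5, X 6]
  retract :=
    ![X (.inl 0), X (.inl 3), X (.inl 4), X (.inr 0), X (.inr 1), X (.inr 2), X (.inr 3)]
  aeval_retract j := by fin_cases j <;> simp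

/-- The operators with `b = 4a`, `c = 6a`, `d = 4a`, `f = 0`. -/
def degenerateFour : PolyEmbedding ℂ (Fin 6 ⊕ Fin 4) (Fin 6) where
  coord := Sum.elim ![X 0, 4 * X 0, 6 * X 0, 4 * X 0, X 1, 0] ![X 2, X 3, X 4, X 5]
  retract := ![X (.inl 0), X (.inl 4), X (.inr 0), X (.inr 1), X (.inr 2), X (.inr 3)]
  aeval_retract j := by fin_cases j <;> simp

/-- The operators with `α + γ = β + δ`, `f = a² / 4`, `b = a (α + γ)`, `d = a (αγ + βδ) / 2` and
`c = d + b / 2`, parametrized by `a, e, α, β, γ`. -/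
def transverse : PolyEmbedding ℂ (Fin 6 ⊕ Fin 4) (Fin 5) where
  coord := Sum.elim
    ![X 0, X 0 * (X 2 + X 4),
      C (1 / 2) * X 0 * (X 2 * X 4 + X 3 * (X 2 + X 4 - X 3) + X 2 + X 4),
      C (1 / 2) * X 0 * (X 2 * X 4 + X 3 * (X 2 + X 4 - X 3)), X 1, C (1 / 4) * X 0 ^ 2]
    ![X 2, X 3, X 4, X 2 + X 4 - X 3]
  retract := ![X (.inl 0), X (.inl 4), X (.inr 0), X (.inr 1), X (.inr 2)]
  aeval_retract j := by fin_cases j <;> simp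

/-- The operators with `b = c = d = 0` and exponents `α, iα, -α, -iα`. -/
def sigmaZero : PolyEmbedding ℂ (Fin 6 ⊕ Fin 4) (Fin 4) where
  coord := Sum.elim ![X 0, 0, 0, 0, X 1, X 2] ![X 3, C I * X 3, -X 3, -(C I * X 3)]
  retract := ![X (.inl 0), X (.inl 4), X (.inl 5), X (.inr 0)]
  aeval_retract j := by fin_cases j <;> simp

/-- The operators with exponents `α, β, 1 - α, 1 - β`, `f = b (2a - b) / 4`,
`d = b (αγ + βδ) / 2` and `c = d + b / 2`, parametrized by `a, b, e, α, β`. -/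
def sigmaOne : PolyEmbedding ℂ (Fin 6 ⊕ Fin 4) (Fin 5) where
  coord := Sum.elim
    ![X 0, X 1,
      C (1 / 2) * X 1 * (X 3 * (1 - X 3) + X 4 * (1 - X 4) + 1),
      C (1 / 2) * X 1 * (X 3 * (1 - X 3) + X 4 * (1 - X 4)), X 2,
      C (1 / 2) * X 1 * (X 0 - C (1 / 2) * X 1)]
    ![X 3, X 4, 1 - X 3, 1 - X 4]
  retract := ![X (.inl 0), X (.inl 1), X (.inl 4), X (.inr 0), X (.inr 1)]
  aeval_retract j := by fin_cases j <;> simp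

/-- The operators with `b = 2a`, `c = a + d` and exponents `α, β, 2 - α, 2 - β`, parametrized by
`a, d, e, f, α, β`. -/
def sigmaTwoMain : PolyEmbedding ℂ (Fin 6 ⊕ Fin 4) (Fin 6) where
  coord := Sum.elim ![X 0, 2 * X 0, X 0 + X 1, X 1, X 2, X 3] ![X 4, X 5, 2 - X 4, 2 - X 5]
  retract := ![X (.inl 0), X (.inl 3), X (.inl 4), X (.inl 5), X (.inr 0), X (.inr 1)]
  aeval_retract j := by fin_cases j <;> simp

/-- The operators with exponents `α, β, 3 - α, 3 - β`, parametrized by `a, b, e, α, β`; here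
`1 + a x + f x² = (1 + u x)(1 + v x)` with `u = b / 2 - a` and `v = 2a - b / 2`. -/
def sigmaThree : PolyEmbedding ℂ (Fin 6 ⊕ Fin 4) (Fin 5) where
  coord := Sum.elim
    ![X 0, X 1,
      6 * (C (1 / 2) * X 1 - X 0)
        + (2 * X 0 - C (1 / 2) * X 1) * (X 3 * (3 - X 3) + X 4 * (3 - X 4) - 3),
      4 * (C (1 / 2) * X 1 - X 0)
        + (2 * X 0 - C (1 / 2) * X 1) * (X 3 * (3 - X 3) + X 4 * (3 - X 4) - 4),
      X 2, (C (1 / 2) * X 1 - X 0) * (2 * X 0 - C (1 / 2) * X 1)]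
    ![X 3, X 4, 3 - X 3, 3 - X 4]
  retract := ![X (.inl 0), X (.inl 1), X (.inl 4), X (.inr 0), X (.inr 1)]
  aeval_retract j := by fin_cases j <;> simp

/-- The operators with `c = 3b / 2`, `d = b`, `f = b (4a - b) / 16` and exponents
`1 + ζ (α - 1)` for `ζ = 1, i, -1, -i`. -/
def sigmaTwoFourthRoots : PolyEmbedding ℂ (Fin 6 ⊕ Fin 4) (Fin 4) where
  coord := Sum.elim
    ![X 0, X 1, C (3 / 2) * X 1, X 1, X 2, C (1 / 4) * X 1 * (X 0 - C (1 / 4) * X 1)]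
    ![X 3, 1 + C I * (X 3 - 1), 2 - X 3, 1 - C I * (X 3 - 1)]
  retract := ![X (.inl 0), X (.inl 1), X (.inl 4), X (.inr 0)]
  aeval_retract j := by fin_cases j <;> simp

/-- The operators with `b = 4a`, `c = 6a`, `d = 4a` and exponents `2 + ζ (α - 2)` for
`ζ = 1, i, -1, -i`. -/
def sigmaFour : PolyEmbedding ℂ (Fin 6 ⊕ Fin 4) (Fin 4) where
  coord := Sum.elim ![X 0, 4 * X 0, 6 * X 0, 4 * X 0, X 1, X 2]
    ![X 3, 2 + C I * (X 3 - 2), 4 - X 3, 2 - C I * (X 3 - 2)]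
  retract := ![X (.inl 0), X (.inl 4), X (.inl 5), X (.inr 0)]
  aeval_retract j := by fin_cases j <;> simp

/-- The ten families, each with the dimension of its parameter space: first the three contained in
`f = 0`, then the transverse one, then those of constant `σ`. -/
def family : Fin 10 → Σ n, PolyEmbedding ℂ (Fin 6 ⊕ Fin 4) (Fin n) :=
  ![⟨6, degenerateZero⟩, ⟨7, degenerateTwo⟩, ⟨6, degenerateFour⟩, ⟨5, transverse⟩,
    ⟨4, sigmaZero⟩, ⟨5, sigmaOne⟩, ⟨6, sigmaTwoMain⟩, ⟨5, sigmaThree⟩,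
    ⟨4, sigmaTwoFourthRoots⟩, ⟨4, sigmaFour⟩]

variable {p : Param}

theorem range_sigmaTwoMain : sigmaTwoMain.range = mainFamily := by
  ext p
  constructor
  · rintro ⟨t, rfl⟩
    refine ⟨t 0, t 1, t 2, t 3, t 4, t 5, ?_⟩
    ext (i | i) <;> fin_cases i <;> simp [PolyEmbedding.point, sigmaTwoMain]
  · rintro ⟨a, d, e, f, α, β, rfl⟩
    refine ⟨![a, d, e, f, α, β], ?_⟩
    ext (i | i) <;> fin_cases i <;> simp [PolyEmbedding.point, sigmaTwoMain]

theorem mem_range_degenerateZero_iff : p ∈ degenerateZero.range ↔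
    p (.inl 1) = 0 ∧ p (.inl 2) = 0 ∧ p (.inl 3) = 0 ∧ p (.inl 5) = 0 := by
  simp [PolyEmbedding.mem_range_iff, degenerateZero, Fin.forall_fin_succ]

theorem mem_range_degenerateTwo_iff : p ∈ degenerateTwo.range ↔
    p (.inl 1) = 2 * p (.inl 0) ∧ p (.inl 2) = p (.inl 0) + p (.inl 3) ∧ p (.inl 5) = 0 := by
  simp [PolyEmbedding.mem_range_iff, degenerateTwo, Fin.forall_fin_succ]

theorem mem_range_degenerateFour_iff : p ∈ degenerateFour.range ↔
    p (.inl 1) = 4 * p (.inl 0) ∧ p (.inl 2) = 6 * p (.inl 0) ∧ p (.inl 3) = 4 * p (.inl 0) ∧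
      p (.inl 5) = 0 := by
  simp [PolyEmbedding.mem_range_iff, degenerateFour, Fin.forall_fin_succ]

theorem mem_range_transverse_iff : p ∈ transverse.range ↔
    p (.inl 1) = p (.inl 0) * (p (.inr 0) + p (.inr 2)) ∧
    p (.inl 2) = 1 / 2 * p (.inl 0) * (p (.inr 0) * p (.inr 2)
      + p (.inr 1) * (p (.inr 0) + p (.inr 2) - p (.inr 1)) + p (.inr 0) + p (.inr 2)) ∧
    p (.inl 3) = 1 / 2 * p (.inl 0) * (p (.inr 0) * p (.inr 2)
      + p (.inr 1) * (p (.inr 0) + p (.inr 2) - p (.inr 1))) ∧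
    p (.inl 5) = 1 / 4 * p (.inl 0) ^ 2 ∧
    p (.inr 3) = p (.inr 0) + p (.inr 2) - p (.inr 1) := by
  simp [PolyEmbedding.mem_range_iff, transverse, Fin.forall_fin_succ, and_assoc]

theorem mem_range_sigmaZero_iff : p ∈ sigmaZero.range ↔
    p (.inl 1) = 0 ∧ p (.inl 2) = 0 ∧ p (.inl 3) = 0 ∧
    p (.inr 1) = I * p (.inr 0) ∧ p (.inr 2) = -p (.inr 0) ∧
    p (.inr 3) = -(I * p (.inr 0)) := by
  simp [PolyEmbedding.mem_range_iff, sigmaZero, Fin.forall_fin_succ, and_assoc]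

theorem mem_range_sigmaOne_iff : p ∈ sigmaOne.range ↔
    p (.inl 2) = 1 / 2 * p (.inl 1) * (p (.inr 0) * (1 - p (.inr 0))
      + p (.inr 1) * (1 - p (.inr 1)) + 1) ∧
    p (.inl 3) = 1 / 2 * p (.inl 1) * (p (.inr 0) * (1 - p (.inr 0))
      + p (.inr 1) * (1 - p (.inr 1))) ∧
    p (.inl 5) = 1 / 2 * p (.inl 1) * (p (.inl 0) - 1 / 2 * p (.inl 1)) ∧
    p (.inr 2) = 1 - p (.inr 0) ∧ p (.inr 3) = 1 - p (.inr 1) := by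
  simp [PolyEmbedding.mem_range_iff, sigmaOne, Fin.forall_fin_succ, and_assoc]

theorem mem_range_sigmaTwoMain_iff : p ∈ sigmaTwoMain.range ↔
    p (.inl 1) = 2 * p (.inl 0) ∧ p (.inl 2) = p (.inl 0) + p (.inl 3) ∧
    p (.inr 2) = 2 - p (.inr 0) ∧ p (.inr 3) = 2 - p (.inr 1) := by
  simp [PolyEmbedding.mem_range_iff, sigmaTwoMain, Fin.forall_fin_succ, and_assoc]

theorem mem_range_sigmaThree_iff : p ∈ sigmaThree.range ↔
    p (.inl 2) = 6 * (1 / 2 * p (.inl 1) - p (.inl 0))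
      + (2 * p (.inl 0) - 1 / 2 * p (.inl 1)) * (p (.inr 0) * (3 - p (.inr 0))
        + p (.inr 1) * (3 - p (.inr 1)) - 3) ∧
    p (.inl 3) = 4 * (1 / 2 * p (.inl 1) - p (.inl 0))
      + (2 * p (.inl 0) - 1 / 2 * p (.inl 1)) * (p (.inr 0) * (3 - p (.inr 0))
        + p (.inr 1) * (3 - p (.inr 1)) - 4) ∧
    p (.inl 5) = (1 / 2 * p (.inl 1) - p (.inl 0)) * (2 * p (.inl 0) - 1 / 2 * p (.inl 1)) ∧
    p (.inr 2) = 3 - p (.inr 0) ∧ p (.inr 3) = 3 - p (.inr 1) := by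
  simp [PolyEmbedding.mem_range_iff, sigmaThree, Fin.forall_fin_succ, and_assoc]

theorem mem_range_sigmaTwoFourthRoots_iff : p ∈ sigmaTwoFourthRoots.range ↔
    p (.inl 2) = 3 / 2 * p (.inl 1) ∧ p (.inl 3) = p (.inl 1) ∧
    p (.inl 5) = 1 / 4 * p (.inl 1) * (p (.inl 0) - 1 / 4 * p (.inl 1)) ∧
    p (.inr 1) = 1 + I * (p (.inr 0) - 1) ∧ p (.inr 2) = 2 - p (.inr 0) ∧
    p (.inr 3) = 1 - I * (p (.inr 0) - 1) := by
  simp [PolyEmbedding.mem_range_iff, sigmaTwoFourthRoots, Fin.forall_fin_succ, and_assoc]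

theorem mem_range_sigmaFour_iff : p ∈ sigmaFour.range ↔
    p (.inl 1) = 4 * p (.inl 0) ∧ p (.inl 2) = 6 * p (.inl 0) ∧ p (.inl 3) = 4 * p (.inl 0) ∧
    p (.inr 1) = 2 + I * (p (.inr 0) - 2) ∧ p (.inr 2) = 4 - p (.inr 0) ∧
    p (.inr 3) = 2 - I * (p (.inr 0) - 2) := by
  simp [PolyEmbedding.mem_range_iff, sigmaFour, Fin.forall_fin_succ, and_assoc]

/-- The exponents are `n + ζ t` with `ζ = 1, i, -1, -i`, in this order. -/
structure HasFourthRootExponents (n : ℂ) (p : Param) : Prop where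
  eq_one : p (.inr 1) = n + I * (p (.inr 0) - n)
  eq_two : p (.inr 2) = 2 * n - p (.inr 0)
  eq_three : p (.inr 3) = n - I * (p (.inr 0) - n)

theorem HasFourthRootExponents.esymm_eq {n : ℂ} (h : HasFourthRootExponents n p) :
    esymmOne p = 4 * n ∧ esymmTwo p = 6 * n ^ 2 ∧ esymmThree p = 4 * n ^ 3 := by
  simp only [esymmOne, esymmTwo, esymmThree, h.eq_one, h.eq_two, h.eq_three]
  exact ⟨by ring, by linear_combination (-(p (.inr 0) - n) ^ 2) * I_sq,
    by linear_combination (-2 * n * (p (.inr 0) - n) ^ 2) * I_sq⟩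

theorem range_degenerateZero_subset_cySet : degenerateZero.range ⊆ cySet := by
  intro p hp
  obtain ⟨hb, hc, hd, hf⟩ := mem_range_degenerateZero_iff.mp hp
  refine mem_cySet_iff.mpr fun j => ?_
  rw [cyEquation, hb, hc, hd, hf]
  fin_cases j <;> simp only [numeratorCoeff, Fin.reduceFinMk, Matrix.cons_val] <;> ring

theorem range_degenerateTwo_subset_cySet : degenerateTwo.range ⊆ cySet := by
  intro p hp
  obtain ⟨hb, hc, hf⟩ := mem_range_degenerateTwo_iff.mp hp
  refine mem_cySet_iff.mpr fun j => ?_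
  rw [cyEquation, hb, hc, hf]
  fin_cases j <;> simp only [numeratorCoeff, Fin.reduceFinMk, Matrix.cons_val] <;> ring

theorem range_degenerateFour_subset_cySet : degenerateFour.range ⊆ cySet := by
  intro p hp
  obtain ⟨hb, hc, hd, hf⟩ := mem_range_degenerateFour_iff.mp hp
  refine mem_cySet_iff.mpr fun j => ?_
  rw [cyEquation, hb, hc, hd, hf]
  fin_cases j <;> simp only [numeratorCoeff, Fin.reduceFinMk, Matrix.cons_val] <;> ring

theorem range_transverse_subset_cySet : transverse.range ⊆ cySet := by
  intro p hp
  obtain ⟨hb, hc, hd, hf, hδ⟩ := mem_range_transverse_iff.mp hp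
  refine mem_cySet_iff.mpr fun j => ?_
  simp only [cyEquation, esymmOne, esymmTwo, esymmThree]
  rw [hb, hc, hd, hf, hδ]
  fin_cases j <;> simp only [numeratorCoeff, Fin.reduceFinMk, Matrix.cons_val] <;> ring

theorem range_sigmaZero_subset_cySet : sigmaZero.range ⊆ cySet := by
  intro p hp
  obtain ⟨hb, hc, hd, hβ, hγ, hδ⟩ := mem_range_sigmaZero_iff.mp hp
  obtain ⟨h₁, h₂, h₃⟩ := HasFourthRootExponents.esymm_eq (n := 0) (p := p)
    ⟨by linear_combination hβ, by linear_combination hγ, by linear_combination hδ⟩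
  refine mem_cySet_iff.mpr fun j => ?_
  rw [cyEquation, hb, hc, hd, h₁, h₂, h₃]
  fin_cases j <;> simp only [numeratorCoeff, Fin.reduceFinMk, Matrix.cons_val] <;> ring

theorem range_sigmaOne_subset_cySet : sigmaOne.range ⊆ cySet := by
  intro p hp
  obtain ⟨hc, hd, hf, hγ, hδ⟩ := mem_range_sigmaOne_iff.mp hp
  refine mem_cySet_iff.mpr fun j => ?_
  simp only [cyEquation, esymmOne, esymmTwo, esymmThree]
  rw [hc, hd, hf, hγ, hδ]
  fin_cases j <;> simp only [numeratorCoeff, Fin.reduceFinMk, Matrix.cons_val] <;> ring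

theorem range_sigmaTwoMain_subset_cySet : sigmaTwoMain.range ⊆ cySet := by
  intro p hp
  obtain ⟨hb, hc, hγ, hδ⟩ := mem_range_sigmaTwoMain_iff.mp hp
  refine mem_cySet_iff.mpr fun j => ?_
  simp only [cyEquation, esymmOne, esymmTwo, esymmThree]
  rw [hb, hc, hγ, hδ]
  fin_cases j <;> simp only [numeratorCoeff, Fin.reduceFinMk, Matrix.cons_val] <;> ring

theorem range_sigmaThree_subset_cySet : sigmaThree.range ⊆ cySet := by
  intro p hp
  obtain ⟨hc, hd, hf, hγ, hδ⟩ := mem_range_sigmaThree_iff.mp hp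
  refine mem_cySet_iff.mpr fun j => ?_
  simp only [cyEquation, esymmOne, esymmTwo, esymmThree]
  rw [hc, hd, hf, hγ, hδ]
  fin_cases j <;> simp only [numeratorCoeff, Fin.reduceFinMk, Matrix.cons_val] <;> ring

theorem range_sigmaTwoFourthRoots_subset_cySet : sigmaTwoFourthRoots.range ⊆ cySet := by
  intro p hp
  obtain ⟨hc, hd, hf, hβ, hγ, hδ⟩ := mem_range_sigmaTwoFourthRoots_iff.mp hp
  obtain ⟨h₁, h₂, h₃⟩ := HasFourthRootExponents.esymm_eq (n := 1) (p := p)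
    ⟨by linear_combination hβ, by linear_combination hγ, by linear_combination hδ⟩
  refine mem_cySet_iff.mpr fun j => ?_
  rw [cyEquation, hc, hd, hf, h₁, h₂, h₃]
  fin_cases j <;> simp only [numeratorCoeff, Fin.reduceFinMk, Matrix.cons_val] <;> ring

theorem range_sigmaFour_subset_cySet : sigmaFour.range ⊆ cySet := by
  intro p hp
  obtain ⟨hb, hc, hd, hβ, hγ, hδ⟩ := mem_range_sigmaFour_iff.mp hp
  obtain ⟨h₁, h₂, h₃⟩ := HasFourthRootExponents.esymm_eq (n := 2) (p := p)
    ⟨by linear_combination hβ, by linear_combination hγ, by linear_combination hδ⟩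
  refine mem_cySet_iff.mpr fun j => ?_
  rw [cyEquation, hb, hc, hd, h₁, h₂, h₃]
  fin_cases j <;> simp only [numeratorCoeff, Fin.reduceFinMk, Matrix.cons_val] <;> ring

theorem range_family_subset_cySet (i : Fin 10) : (family i).2.range ⊆ cySet := by
  fin_cases i
  exacts [range_degenerateZero_subset_cySet,
    range_degenerateTwo_subset_cySet,
    range_degenerateFour_subset_cySet,
    range_transverse_subset_cySet,
    range_sigmaZero_subset_cySet,
    range_sigmaOne_subset_cySet,
    range_sigmaTwoMain_subset_cySet,
    range_sigmaThree_subset_cySet,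
    range_sigmaTwoFourthRoots_subset_cySet,
    range_sigmaFour_subset_cySet]

end Families

section Solve

open Complex

variable {p : Param} {u v r₁ r₂ k₁ k₂ : ℂ}

-- Multiplied by `(-u)⁶`, the numerator of `𝒬` takes this value at the root `-1 / u` of
-- `1 + a x + f x²`.
theorem numeratorCoeff_eval_root (d s₃ : ℂ) :
    ∑ j, numeratorCoeff (u + v) (r₁ * u + r₂ * v) (k₁ * u + k₂ * v) d (u * v) (r₁ + r₂)
      (k₁ + k₂) s₃ j * (-u) ^ (5 - j : ℕ) = u ^ 3 * (u - v) ^ 3 * (r₁ * (r₁ - 2) * (r₁ - 4)) := by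
  simp only [numeratorCoeff, Fin.sum_univ_six, Matrix.cons_val, Fin.isValue, Fin.coe_ofNat_eq_mod,
    Nat.reduceMod, Nat.reduceSub]
  ring

-- Likewise `(-u)⁵` times the derivative of the numerator at `-1 / u`.
theorem numeratorCoeff_deriv_eval_root (d s₃ : ℂ) :
    ∑ j : Fin 6, ((j : ℕ) + 1) * numeratorCoeff (u + v) (r₁ * u + r₂ * v) (k₁ * u + k₂ * v) d
      (u * v) (r₁ + r₂) (k₁ + k₂) s₃ j * (-u) ^ (5 - j : ℕ) =
    3 * u ^ 3 * (u - v) ^ 2 * (u - 2 * v) * (r₁ * (r₁ - 2) * (r₁ - 4)) +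
      u ^ 3 * (u - v) ^ 2 * ((r₁ - 2) *
        (4 * k₁ * (v - u) - 3 * v * r₁ * r₂ - 6 * r₁ * (v - u))) := by
  simp only [numeratorCoeff, Fin.sum_univ_six, Matrix.cons_val, Fin.isValue, Fin.coe_ofNat_eq_mod,
    Nat.reduceMod, Nat.reduceSub, Nat.cast_zero, Nat.cast_one, Nat.cast_ofNat]
  ring

theorem numeratorCoeff_eval_double_root (b c d s₁ s₂ s₃ : ℂ) :
    ∑ j, numeratorCoeff (2 * u) b c d (u ^ 2) s₁ s₂ s₃ j * (-u) ^ (5 - j : ℕ) =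
      u ^ 3 * (b - u * s₁) ^ 3 := by
  simp only [numeratorCoeff, Fin.sum_univ_six, Matrix.cons_val, Fin.isValue, Fin.coe_ofNat_eq_mod,
    Nat.reduceMod, Nat.reduceSub]
  ring

-- The combination of the coefficients that eliminates `d` and `s₃`.
theorem numeratorCoeff_double_root_combination (c d s₁ s₂ s₃ : ℂ) :
    let N := numeratorCoeff (2 * u) (u * s₁) c d (u ^ 2) s₁ s₂ s₃
    N 5 - u ^ 4 * N 1 + 4 * u ^ 5 * N 0 =
      u ^ 5 * ((s₁ - 4) * (4 * (u * s₂ - c) - u * s₁ * (s₁ - 2))) := by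
  simp only [numeratorCoeff, Matrix.cons_val, Fin.isValue]
  ring

theorem coeff_d_eq (hp : p ∈ cySet) : p (.inl 3) = p (.inl 2) - p (.inl 1) / 2 := by
  have h : 8 * p (.inl 2) - 4 * p (.inl 1) - 8 * p (.inl 3) = 0 := mem_cySet_iff.mp hp 0
  linear_combination -(1 / 8) * h

/-- The factorization `1 + a x + f x² = (1 + u x)(1 + v x)` with `u ≠ v`, together with the partial
fraction expansions `A₃ = r₁ u x / (1 + u x) + r₂ v x / (1 + v x)` and
`A₂ = k₁ u x / (1 + u x) + k₂ v x / (1 + v x)`, written as equations between the coefficients. -/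
structure PartialFractions (p : Param) (u v r₁ r₂ k₁ k₂ : ℂ) : Prop where
  ne : u ≠ v
  a_eq : p (.inl 0) = u + v
  f_eq : p (.inl 5) = u * v
  b_eq : p (.inl 1) = r₁ * u + r₂ * v
  esymmOne_eq : esymmOne p = r₁ + r₂
  c_eq : p (.inl 2) = k₁ * u + k₂ * v
  esymmTwo_eq : esymmTwo p = k₁ + k₂

theorem exists_partialFractions (hne : u ≠ v) (ha : p (.inl 0) = u + v)
    (hf : p (.inl 5) = u * v) : ∃ r₁ r₂ k₁ k₂, PartialFractions p u v r₁ r₂ k₁ k₂ := by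
  have h : u - v ≠ 0 := sub_ne_zero.mpr hne
  refine ⟨(p (.inl 1) - v * esymmOne p) / (u - v), (u * esymmOne p - p (.inl 1)) / (u - v),
    (p (.inl 2) - v * esymmTwo p) / (u - v), (u * esymmTwo p - p (.inl 2)) / (u - v),
    hne, ha, hf, ?_, ?_, ?_, ?_⟩ <;>
    field_simp <;> ring

namespace PartialFractions

theorem symm (h : PartialFractions p u v r₁ r₂ k₁ k₂) : PartialFractions p v u r₂ r₁ k₂ k₁ where
  ne := h.ne.symm
  a_eq := h.a_eq.trans (add_comm _ _)
  f_eq := h.f_eq.trans (mul_comm _ _)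
  b_eq := h.b_eq.trans (add_comm _ _)
  esymmOne_eq := h.esymmOne_eq.trans (add_comm _ _)
  c_eq := h.c_eq.trans (add_comm _ _)
  esymmTwo_eq := h.esymmTwo_eq.trans (add_comm _ _)

theorem cyEquation_eq (h : PartialFractions p u v r₁ r₂ k₁ k₂) :
    cyEquation p = numeratorCoeff (u + v) (r₁ * u + r₂ * v) (k₁ * u + k₂ * v) (p (.inl 3)) (u * v)
      (r₁ + r₂) (k₁ + k₂) (esymmThree p) := by
  rw [cyEquation, h.a_eq, h.b_eq, h.c_eq, h.f_eq, h.esymmOne_eq, h.esymmTwo_eq]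

theorem residue_cubic (h : PartialFractions p u v r₁ r₂ k₁ k₂) (hp : p ∈ cySet) (hu : u ≠ 0) :
    r₁ * (r₁ - 2) * (r₁ - 4) = 0 := by
  have hroot := numeratorCoeff_eval_root (u := u) (v := v) (r₁ := r₁) (r₂ := r₂) (k₁ := k₁)
    (k₂ := k₂) (p (.inl 3)) (esymmThree p)
  rw [← h.cyEquation_eq] at hroot
  simp only [mem_cySet_iff.mp hp, zero_mul, Finset.sum_const_zero] at hroot
  exact (mul_eq_zero_iff_left (mul_ne_zero (pow_ne_zero 3 hu)
    (pow_ne_zero 3 (sub_ne_zero.mpr h.ne)))).mp hroot.symm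

theorem residue_eq (h : PartialFractions p u v r₁ r₂ k₁ k₂) (hp : p ∈ cySet) (hu : u ≠ 0) :
    r₁ = 0 ∨ r₁ = 2 ∨ r₁ = 4 := by
  simpa only [mul_eq_zero, sub_eq_zero, or_assoc] using h.residue_cubic hp hu

theorem residue_linear (h : PartialFractions p u v r₁ r₂ k₁ k₂) (hp : p ∈ cySet) (hu : u ≠ 0)
    (hr : r₁ ≠ 2) : 4 * k₁ * (v - u) = 3 * v * r₁ * r₂ + 6 * r₁ * (v - u) := by
  have hroot := numeratorCoeff_deriv_eval_root (u := u) (v := v) (r₁ := r₁) (r₂ := r₂) (k₁ := k₁)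
    (k₂ := k₂) (p (.inl 3)) (esymmThree p)
  rw [← h.cyEquation_eq] at hroot
  simp only [mem_cySet_iff.mp hp, mul_zero, zero_mul, Finset.sum_const_zero,
    h.residue_cubic hp hu, zero_add] at hroot
  have hlin := (mul_eq_zero_iff_left (mul_ne_zero (pow_ne_zero 3 hu)
    (pow_ne_zero 2 (sub_ne_zero.mpr h.ne)))).mp hroot.symm
  linear_combination (mul_eq_zero_iff_left (sub_ne_zero.mpr hr)).mp hlin

theorem eq_zero_of_residue_eq_zero (h : PartialFractions p u v 0 r₂ k₁ k₂) (hp : p ∈ cySet)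
    (hu : u ≠ 0) : k₁ = 0 :=
  mul_right_cancel₀ (sub_ne_zero.mpr h.ne.symm)
    (by linear_combination (1 / 4) * h.residue_linear hp hu two_ne_zero.symm)

end PartialFractions

/-- The exponents pair up with equal sums: `α + γ = β + δ`. -/
def IsBalanced (p : Param) : Prop := p (.inr 0) + p (.inr 2) = p (.inr 1) + p (.inr 3)

theorem exists_isBalanced_permuteExponents (hp : p ∈ cySet) (hf : p (.inl 5) ≠ 0) :
    ∃ τ, IsBalanced (permuteExponents τ p) := by
  have hlast :
      p (.inl 5) ^ 3 * (4 * esymmOne p * esymmTwo p - 8 * esymmThree p - esymmOne p ^ 3) = 0 :=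
    mem_cySet_iff.mp hp 5
  have hprod : (p (.inr 0) + p (.inr 2) - (p (.inr 1) + p (.inr 3))) *
      ((p (.inr 0) + p (.inr 1) - (p (.inr 2) + p (.inr 3))) *
        (p (.inr 0) + p (.inr 3) - (p (.inr 1) + p (.inr 2)))) = 0 := by
    have hcubic := (mul_eq_zero_iff_left (pow_ne_zero 3 hf)).mp hlast
    simp only [esymmOne, esymmTwo, esymmThree] at hcubic
    linear_combination -hcubic
  simp only [mul_eq_zero, sub_eq_zero] at hprod
  rcases hprod with h | h | h
  · exact ⟨1, h⟩
  · exact ⟨Equiv.swap 1 2, h⟩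
  · exact ⟨Equiv.swap 2 3, h⟩

namespace IsBalanced

variable {m n : ℂ}

theorem gamma_eq (h : IsBalanced p) (hm : esymmOne p = 2 * m) :
    p (.inr 2) = m - p (.inr 0) := by
  unfold IsBalanced at h
  unfold esymmOne at hm
  linear_combination (h + hm) / 2

theorem delta_eq (h : IsBalanced p) (hm : esymmOne p = 2 * m) :
    p (.inr 3) = m - p (.inr 1) := by
  unfold IsBalanced at h
  unfold esymmOne at hm
  linear_combination (hm - h) / 2

theorem esymmTwo_eq (h : IsBalanced p) (hm : esymmOne p = 2 * m) :
    esymmTwo p = m ^ 2 + p (.inr 0) * (m - p (.inr 0)) + p (.inr 1) * (m - p (.inr 1)) := by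
  rw [esymmTwo, h.gamma_eq hm, h.delta_eq hm]
  ring

theorem exists_hasFourthRootExponents (h : IsBalanced p) (h₁ : esymmOne p = 4 * n)
    (h₂ : esymmTwo p = 6 * n ^ 2) : ∃ τ, HasFourthRootExponents n (permuteExponents τ p) := by
  have hm : esymmOne p = 2 * (2 * n) := by rw [h₁]; ring
  have hγ := h.gamma_eq hm
  have hδ := h.delta_eq hm
  have hsq : (p (.inr 1) - n) ^ 2 = (I * (p (.inr 0) - n)) ^ 2 := by
    linear_combination h.esymmTwo_eq hm - h₂ - (p (.inr 0) - n) ^ 2 * I_sq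
  rcases sq_eq_sq_iff_eq_or_eq_neg.mp hsq with hβ | hβ
  · have h₁ : p (.inr 1) = n + I * (p (.inr 0) - n) := by linear_combination hβ
    have h₃ : p (.inr 3) = n - I * (p (.inr 0) - n) := by linear_combination hδ - hβ
    exact ⟨1, h₁, hγ, h₃⟩
  · have h₁ : p (.inr 1) = n - I * (p (.inr 0) - n) := by linear_combination hβ
    have h₃ : p (.inr 3) = n + I * (p (.inr 0) - n) := by linear_combination hδ - hβ
    exact ⟨Equiv.swap 1 3, h₃, hγ, h₁⟩

end IsBalanced

theorem exists_mem_range_family_of_f_eq_zero (hp : p ∈ cySet) (hf : p (.inl 5) = 0) :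
    ∃ i, p ∈ (family i).2.range := by
  have hd := coeff_d_eq hp
  by_cases ha : p (.inl 0) = 0
  · have h₂ := mem_cySet_iff.mp hp 2
    have hb : p (.inl 1) = 0 := by
      simpa [cyEquation, numeratorCoeff, ha, hf] using h₂
    refine ⟨1, mem_range_degenerateTwo_iff.mpr ⟨?_, ?_, hf⟩⟩
    · rw [hb, ha, mul_zero]
    · rw [hd, ha, hb]; ring
  · obtain ⟨r₁, r₂, k₁, k₂, h⟩ :=
      exists_partialFractions (p := p) (v := 0) ha (add_zero _).symm (hf.trans (mul_zero _).symm)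
    have hb : p (.inl 1) = r₁ * p (.inl 0) := by simpa using h.b_eq
    have hc : p (.inl 2) = k₁ * p (.inl 0) := by simpa using h.c_eq
    have hlin (hr : r₁ ≠ 2) : 2 * k₁ = 3 * r₁ :=
      mul_right_cancel₀ ha (by linear_combination -(1 / 2) * h.residue_linear hp ha hr)
    rcases h.residue_eq hp ha with rfl | rfl | rfl
    · have hk : k₁ = 0 := by linear_combination (1 / 2) * hlin (by norm_num)
      subst hk
      refine ⟨0, mem_range_degenerateZero_iff.mpr ⟨?_, ?_, ?_, hf⟩⟩
      · rw [hb]; ring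
      · rw [hc]; ring
      · rw [hd, hb, hc]; ring
    · exact ⟨1, mem_range_degenerateTwo_iff.mpr ⟨hb, by rw [hd, hb]; ring, hf⟩⟩
    · have hk : k₁ = 6 := by linear_combination (1 / 2) * hlin (by norm_num)
      subst hk
      refine ⟨2, mem_range_degenerateFour_iff.mpr ⟨hb, hc, ?_, hf⟩⟩
      rw [hd, hb, hc]; ring

theorem coeff_b_eq_of_double_root (hp : p ∈ cySet) (hu : u ≠ 0) (ha : p (.inl 0) = 2 * u)
    (hf : p (.inl 5) = u ^ 2) : p (.inl 1) = u * esymmOne p := by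
  have hroot := numeratorCoeff_eval_double_root (u := u) (p (.inl 1)) (p (.inl 2)) (p (.inl 3))
    (esymmOne p) (esymmTwo p) (esymmThree p)
  rw [← ha, ← hf, ← cyEquation] at hroot
  simp only [mem_cySet_iff.mp hp, zero_mul, Finset.sum_const_zero] at hroot
  exact sub_eq_zero.mp (pow_eq_zero_iff three_ne_zero |>.mp
    ((mul_eq_zero_iff_left (pow_ne_zero 3 hu)).mp hroot.symm))

theorem mem_range_of_double_root (hp : p ∈ cySet) (hbal : IsBalanced p) (hu : u ≠ 0)
    (ha : p (.inl 0) = 2 * u) (hf : p (.inl 5) = u ^ 2) :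
    p ∈ transverse.range ∨ p ∈ sigmaTwoMain.range := by
  have hb := coeff_b_eq_of_double_root hp hu ha hf
  have hd := coeff_d_eq hp
  have hcomb := numeratorCoeff_double_root_combination (u := u) (p (.inl 2)) (p (.inl 3))
    (esymmOne p) (esymmTwo p) (esymmThree p)
  rw [← hb, ← ha, ← hf, ← cyEquation] at hcomb
  simp only [mem_cySet_iff.mp hp, mul_zero, sub_zero, add_zero] at hcomb
  rcases mul_eq_zero.mp ((mul_eq_zero_iff_left (pow_ne_zero 5 hu)).mp hcomb.symm) with h | h
  · have hm : esymmOne p = 2 * 2 := by linear_combination h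
    rw [hm] at hb
    exact .inr (mem_range_sigmaTwoMain_iff.mpr ⟨by rw [hb, ha]; ring, by rw [hd, hb, ha]; ring,
      hbal.gamma_eq hm, hbal.delta_eq hm⟩)
  · have hm : esymmOne p = 2 * (p (.inr 0) + p (.inr 2)) := by
      unfold IsBalanced at hbal
      unfold esymmOne
      linear_combination -hbal
    rw [hbal.esymmTwo_eq hm, hm] at h
    rw [hm] at hb
    have hc : p (.inl 2) = u * (p (.inr 0) * p (.inr 2)
        + p (.inr 1) * (p (.inr 0) + p (.inr 2) - p (.inr 1)) + p (.inr 0) + p (.inr 2)) := by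
      linear_combination -(1 / 4) * h - (p (.inr 0) + p (.inr 2) - 1) / 2 * hb
    exact .inl (mem_range_transverse_iff.mpr ⟨by rw [hb, ha]; ring, by rw [hc, ha]; ring,
      by rw [hd, hb, hc, ha]; ring, by rw [hf, ha]; ring, hbal.delta_eq hm⟩)

theorem exists_permuteExponents_mem_of_mem {i : Fin 10} (h : p ∈ (family i).2.range) :
    ∃ i τ, permuteExponents τ p ∈ (family i).2.range :=
  ⟨i, 1, by rwa [permuteExponents_one]⟩

namespace PartialFractions

theorem mem_range_sigmaZero (h : PartialFractions p u v 0 0 k₁ k₂) (hp : p ∈ cySet) (hu : u ≠ 0)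
    (hv : v ≠ 0) (hbal : IsBalanced p) : ∃ τ, permuteExponents τ p ∈ sigmaZero.range := by
  have hk₁ := h.eq_zero_of_residue_eq_zero hp hu
  have hk₂ := h.symm.eq_zero_of_residue_eq_zero hp hv
  subst hk₁ hk₂
  have hb : p (.inl 1) = 0 := by linear_combination h.b_eq
  have hc : p (.inl 2) = 0 := by linear_combination h.c_eq
  have hd : p (.inl 3) = 0 := by linear_combination coeff_d_eq hp + hc - hb / 2
  obtain ⟨τ, hτ⟩ := hbal.exists_hasFourthRootExponents (n := 0)
    (by linear_combination h.esymmOne_eq) (by linear_combination h.esymmTwo_eq)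
  exact ⟨τ, mem_range_sigmaZero_iff.mpr ⟨hb, hc, hd, by linear_combination hτ.eq_one,
    by linear_combination hτ.eq_two, by linear_combination hτ.eq_three⟩⟩

theorem mem_range_sigmaOne (h : PartialFractions p u v 0 2 k₁ k₂) (hp : p ∈ cySet) (hu : u ≠ 0)
    (hbal : IsBalanced p) : p ∈ sigmaOne.range := by
  have hk₁ := h.eq_zero_of_residue_eq_zero hp hu
  subst hk₁
  have hm : esymmOne p = 2 * 1 := by linear_combination h.esymmOne_eq
  have hk₂ := h.esymmTwo_eq.symm.trans (hbal.esymmTwo_eq hm)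
  have hv : v = 1 / 2 * p (.inl 1) := by linear_combination -(1 / 2) * h.b_eq
  have hc : p (.inl 2) = 1 / 2 * p (.inl 1) * (p (.inr 0) * (1 - p (.inr 0))
      + p (.inr 1) * (1 - p (.inr 1)) + 1) := by
    rw [← hv]
    linear_combination h.c_eq + v * hk₂
  exact mem_range_sigmaOne_iff.mpr ⟨hc, by rw [coeff_d_eq hp, hc]; ring,
    by rw [← hv, h.f_eq, h.a_eq]; ring, hbal.gamma_eq hm, hbal.delta_eq hm⟩

theorem mem_range_sigmaTwoMain (h : PartialFractions p u v 2 2 k₁ k₂) (hp : p ∈ cySet)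
    (hbal : IsBalanced p) : p ∈ sigmaTwoMain.range := by
  have hm : esymmOne p = 2 * 2 := by linear_combination h.esymmOne_eq
  exact mem_range_sigmaTwoMain_iff.mpr ⟨by rw [h.b_eq, h.a_eq]; ring,
    by rw [coeff_d_eq hp, h.b_eq, h.a_eq]; ring, hbal.gamma_eq hm, hbal.delta_eq hm⟩

theorem mem_range_sigmaTwoFourthRoots (h : PartialFractions p u v 0 4 k₁ k₂) (hp : p ∈ cySet)
    (hu : u ≠ 0) (hv : v ≠ 0) (hbal : IsBalanced p) :
    ∃ τ, permuteExponents τ p ∈ sigmaTwoFourthRoots.range := by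
  have hk₁ := h.eq_zero_of_residue_eq_zero hp hu
  have hk₂ : k₂ = 6 := mul_right_cancel₀ (sub_ne_zero.mpr h.ne)
    (by linear_combination (1 / 4) * h.symm.residue_linear hp hv (by norm_num))
  subst hk₁ hk₂
  have hc : p (.inl 2) = 3 / 2 * p (.inl 1) := by linear_combination h.c_eq - 3 / 2 * h.b_eq
  have hd : p (.inl 3) = p (.inl 1) := by linear_combination coeff_d_eq hp + hc
  have hf : p (.inl 5) = 1 / 4 * p (.inl 1) * (p (.inl 0) - 1 / 4 * p (.inl 1)) := by
    rw [h.f_eq, h.b_eq, h.a_eq]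
    ring
  obtain ⟨τ, hτ⟩ := hbal.exists_hasFourthRootExponents (n := 1)
    (by linear_combination h.esymmOne_eq) (by linear_combination h.esymmTwo_eq)
  exact ⟨τ, mem_range_sigmaTwoFourthRoots_iff.mpr ⟨hc, hd, hf, hτ.eq_one,
    by linear_combination hτ.eq_two, hτ.eq_three⟩⟩

theorem mem_range_sigmaThree (h : PartialFractions p u v 2 4 k₁ k₂) (hp : p ∈ cySet) (hv : v ≠ 0)
    (hbal : IsBalanced p) : p ∈ sigmaThree.range := by
  have hm : esymmOne p = 2 * 3 := by linear_combination h.esymmOne_eq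
  have hk₂ := h.symm.residue_linear hp hv (by norm_num)
  have hs₂ := h.esymmTwo_eq.symm.trans (hbal.esymmTwo_eq hm)
  have hc : p (.inl 2) = 6 * v + u * (p (.inr 0) * (3 - p (.inr 0))
      + p (.inr 1) * (3 - p (.inr 1)) - 3) := by
    linear_combination h.c_eq + u * hs₂ - (1 / 4) * hk₂
  have hu' : 2 * p (.inl 0) - 1 / 2 * p (.inl 1) = u := by
    linear_combination 2 * h.a_eq - (1 / 2) * h.b_eq
  have hv' : 1 / 2 * p (.inl 1) - p (.inl 0) = v := by
    linear_combination (1 / 2) * h.b_eq - h.a_eq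
  rw [mem_range_sigmaThree_iff, hu', hv']
  exact ⟨hc, by rw [coeff_d_eq hp, hc, h.b_eq]; ring, by rw [h.f_eq, mul_comm],
    hbal.gamma_eq hm, hbal.delta_eq hm⟩

theorem mem_range_sigmaFour (h : PartialFractions p u v 4 4 k₁ k₂) (hp : p ∈ cySet) (hu : u ≠ 0)
    (hv : v ≠ 0) (hbal : IsBalanced p) : ∃ τ, permuteExponents τ p ∈ sigmaFour.range := by
  have hne : v - u ≠ 0 := sub_ne_zero.mpr h.ne.symm
  have hk₁ := h.residue_linear hp hu (by norm_num)
  have hk₂ := h.symm.residue_linear hp hv (by norm_num)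
  have hk : k₁ + k₂ = 24 := mul_right_cancel₀ hne (by linear_combination (1 / 4) * (hk₁ - hk₂))
  have hku : k₁ * u + k₂ * v = 6 * (u + v) :=
    mul_right_cancel₀ hne (by linear_combination (1 / 4) * (u * hk₁ - v * hk₂))
  have hb : p (.inl 1) = 4 * p (.inl 0) := by linear_combination h.b_eq - 4 * h.a_eq
  have hc : p (.inl 2) = 6 * p (.inl 0) := by rw [h.c_eq, hku, h.a_eq]
  have hd : p (.inl 3) = 4 * p (.inl 0) := by linear_combination coeff_d_eq hp + hc - hb / 2
  obtain ⟨τ, hτ⟩ := hbal.exists_hasFourthRootExponents (n := 2)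
    (by linear_combination h.esymmOne_eq) (by linear_combination h.esymmTwo_eq + hk)
  exact ⟨τ, mem_range_sigmaFour_iff.mpr ⟨hb, hc, hd, hτ.eq_one,
    by linear_combination hτ.eq_two, hτ.eq_three⟩⟩

theorem exists_mem_range_family (h : PartialFractions p u v r₁ r₂ k₁ k₂) (hp : p ∈ cySet)
    (hu : u ≠ 0) (hv : v ≠ 0) (hbal : IsBalanced p) :
    ∃ i τ, permuteExponents τ p ∈ (family i).2.range := by
  rcases h.residue_eq hp hu with rfl | rfl | rfl <;>
    rcases h.symm.residue_eq hp hv with rfl | rfl | rfl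
  · exact ⟨4, h.mem_range_sigmaZero hp hu hv hbal⟩
  · exact exists_permuteExponents_mem_of_mem (i := 5) (h.mem_range_sigmaOne hp hu hbal)
  · exact ⟨8, h.mem_range_sigmaTwoFourthRoots hp hu hv hbal⟩
  · exact exists_permuteExponents_mem_of_mem (i := 5) (h.symm.mem_range_sigmaOne hp hv hbal)
  · exact exists_permuteExponents_mem_of_mem (i := 6) (h.mem_range_sigmaTwoMain hp hbal)
  · exact exists_permuteExponents_mem_of_mem (i := 7) (h.mem_range_sigmaThree hp hv hbal)
  · exact ⟨8, h.symm.mem_range_sigmaTwoFourthRoots hp hv hu hbal⟩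
  · exact exists_permuteExponents_mem_of_mem (i := 7) (h.symm.mem_range_sigmaThree hp hu hbal)
  · exact ⟨9, h.mem_range_sigmaFour hp hu hv hbal⟩

end PartialFractions

theorem exists_factorization (a f : ℂ) : ∃ u v, a = u + v ∧ f = u * v := by
  obtain ⟨s, hs⟩ := IsAlgClosed.exists_pow_nat_eq (a ^ 2 - 4 * f) two_pos
  exact ⟨(a + s) / 2, (a - s) / 2, by ring, by linear_combination (1 / 4) * hs⟩

theorem exists_permuteExponents_mem_range_family (hp : p ∈ cySet) :
    ∃ i τ, permuteExponents τ p ∈ (family i).2.range := by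
  by_cases hf : p (.inl 5) = 0
  · obtain ⟨i, hi⟩ := exists_mem_range_family_of_f_eq_zero hp hf
    exact exists_permuteExponents_mem_of_mem hi
  obtain ⟨ρ, hbal⟩ := exists_isBalanced_permuteExponents hp hf
  suffices h : ∃ i τ, permuteExponents τ (permuteExponents ρ p) ∈ (family i).2.range by
    obtain ⟨i, τ, hi⟩ := h
    exact ⟨i, ρ * τ, by rwa [← permuteExponents_permuteExponents]⟩
  rw [← permuteExponents_mem_cySet_iff (τ := ρ)] at hp
  obtain ⟨u, v, ha, huv⟩ := exists_factorization (p (.inl 0)) (p (.inl 5))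
  have hu : u ≠ 0 := left_ne_zero_of_mul (huv ▸ hf)
  have hv : v ≠ 0 := right_ne_zero_of_mul (huv ▸ hf)
  by_cases hne : u = v
  · subst hne
    rcases mem_range_of_double_root hp hbal hu (ha.trans (two_mul u).symm)
      (huv.trans (sq u).symm) with h | h
    · exact exists_permuteExponents_mem_of_mem (i := 3) h
    · exact exists_permuteExponents_mem_of_mem (i := 6) h
  · obtain ⟨r₁, r₂, k₁, k₂, h⟩ :=
      exists_partialFractions (p := permuteExponents ρ p) hne ha huv
    exact h.exists_mem_range_family hp hu hv hbal

end Solve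

section Components

variable {p : Param} {i j : Fin 10} {Z : Set Param}

/-- The ten families and their images under reorderings of the exponents. -/
def components : Set (Set Param) :=
  Set.range fun x : Fin 10 × Equiv.Perm (Fin 4) => permuteExponents x.2 '' (family x.1).2.range

theorem cySet_eq_sUnion_components : cySet = ⋃₀ components := by
  refine Set.Subset.antisymm (fun p hp => ?_) (Set.sUnion_subset ?_)
  · obtain ⟨i, τ, h⟩ := exists_permuteExponents_mem_range_family hp
    refine ⟨_, ⟨(i, τ⁻¹), rfl⟩, ?_⟩
    rwa [mem_image_permuteExponents, inv_inv]
  · rintro _ ⟨⟨i, τ⟩, rfl⟩ _ ⟨p, hp, rfl⟩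
    exact permuteExponents_mem_cySet_iff.mpr (range_family_subset_cySet i hp)

theorem isIrreducibleAlgebraicSet_of_mem_components (hZ : Z ∈ components) :
    IsIrreducibleAlgebraicSet Z := by
  obtain ⟨⟨i, τ⟩, rfl⟩ := hZ
  exact isIrreducibleAlgebraicSet_permuteExponents_image _ τ

theorem sigma_eq_of_mem_range_family (j : Fin 6) (hp : p ∈ (family (Fin.natAdd 4 j)).2.range) :
    sigma p = (![0, 1, 2, 3, 2, 4] : Fin 6 → ℂ) j := by
  rw [sigma, Fin.sum_univ_four, div_eq_iff two_ne_zero]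
  fin_cases j <;> simp only [Fin.zero_eta, Fin.mk_one, Fin.reduceFinMk, Matrix.cons_val]
  · obtain ⟨-, -, -, hβ, hγ, hδ⟩ := mem_range_sigmaZero_iff.mp hp
    linear_combination hβ + hγ + hδ
  · obtain ⟨-, -, -, hγ, hδ⟩ := mem_range_sigmaOne_iff.mp hp
    linear_combination hγ + hδ
  · obtain ⟨-, -, hγ, hδ⟩ := mem_range_sigmaTwoMain_iff.mp hp
    linear_combination hγ + hδ
  · obtain ⟨-, -, -, hγ, hδ⟩ := mem_range_sigmaThree_iff.mp hp
    linear_combination hγ + hδ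
  · obtain ⟨-, -, -, hβ, hγ, hδ⟩ := mem_range_sigmaTwoFourthRoots_iff.mp hp
    linear_combination hβ + hγ + hδ
  · obtain ⟨-, -, -, hβ, hγ, hδ⟩ := mem_range_sigmaFour_iff.mp hp
    linear_combination hβ + hγ + hδ

/-- Equations that do not depend on the order of the exponents and hold on the `i`-th family; they
are chosen to fail at the points `separatingPoint j` of the other families. -/
def separatingCondition (p : Param) : Fin 10 → Prop :=
  ![p (.inl 5) = 0 ∧ p (.inl 1) = 0,
    p (.inl 5) = 0 ∧ p (.inl 1) = 2 * p (.inl 0),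
    p (.inl 5) = 0 ∧ p (.inl 1) = 4 * p (.inl 0),
    p (.inl 0) ^ 2 = 4 * p (.inl 5),
    sigma p = 0,
    sigma p = 1,
    sigma p = 2 ∧ p (.inl 1) = 2 * p (.inl 0),
    sigma p = 3,
    sigma p = 2 ∧ 2 * p (.inl 2) = 3 * p (.inl 1),
    sigma p = 4]

theorem separatingCondition_permuteExponents (τ : Equiv.Perm (Fin 4)) (p : Param) :
    separatingCondition (permuteExponents τ p) = separatingCondition p := by
  simp only [separatingCondition, sigma_permuteExponents]
  rfl

theorem separatingCondition_of_mem (hp : p ∈ (family i).2.range) : separatingCondition p i := by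
  fin_cases i
  · obtain ⟨hb, -, -, hf⟩ := mem_range_degenerateZero_iff.mp hp
    exact ⟨hf, hb⟩
  · obtain ⟨hb, -, hf⟩ := mem_range_degenerateTwo_iff.mp hp
    exact ⟨hf, hb⟩
  · obtain ⟨hb, -, -, hf⟩ := mem_range_degenerateFour_iff.mp hp
    exact ⟨hf, hb⟩
  · obtain ⟨-, -, -, hf, -⟩ := mem_range_transverse_iff.mp hp
    change p (.inl 0) ^ 2 = 4 * p (.inl 5)
    linear_combination -4 * hf
  · exact sigma_eq_of_mem_range_family 0 hp
  · exact sigma_eq_of_mem_range_family 1 hp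
  · exact ⟨sigma_eq_of_mem_range_family 2 hp, (mem_range_sigmaTwoMain_iff.mp hp).1⟩
  · exact sigma_eq_of_mem_range_family 3 hp
  · refine ⟨sigma_eq_of_mem_range_family 4 hp, ?_⟩
    linear_combination 2 * (mem_range_sigmaTwoFourthRoots_iff.mp hp).1
  · exact sigma_eq_of_mem_range_family 5 hp

/-- A point of the `i`-th family at which no other `separatingCondition` holds. -/
def separatingPoint : Fin 10 → Param :=
  ![Sum.elim ![1, 0, 0, 0, 0, 0] ![10, 0, 0, 0],
    Sum.elim ![1, 2, 1, 0, 0, 0] ![10, 0, 0, 0],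
    Sum.elim ![1, 4, 6, 4, 0, 0] ![10, 0, 0, 0],
    Sum.elim ![2, 10, 5, 0, 0, 1] ![0, 0, 5, 5],
    Sum.elim ![0, 0, 0, 0, 0, 1] ![0, 0, 0, 0],
    Sum.elim ![3, 4, 2, 0, 0, 2] ![0, 0, 1, 1],
    Sum.elim ![0, 0, 1, 1, 0, 1] ![0, 0, 2, 2],
    Sum.elim ![3, 8, 8, 4, 0, 2] ![1, 1, 2, 2],
    Sum.elim ![3, 8, 12, 8, 0, 2] ![1, 1, 1, 1],
    Sum.elim ![0, 0, 0, 0, 0, 1] ![2, 2, 2, 2]]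

theorem separatingPoint_mem_range_family (i : Fin 10) :
    separatingPoint i ∈ (family i).2.range := by
  fin_cases i <;>
    simp only [separatingPoint, Fin.zero_eta, Fin.mk_one, Fin.reduceFinMk, Matrix.cons_val]
  · exact mem_range_degenerateZero_iff.mpr (by simp)
  · exact mem_range_degenerateTwo_iff.mpr (by simp)
  · exact mem_range_degenerateFour_iff.mpr (by simp)
  · exact mem_range_transverse_iff.mpr <| by
      simp only [Sum.elim_inl, Sum.elim_inr, Matrix.cons_val]
      norm_num
  · exact mem_range_sigmaZero_iff.mpr (by simp)
  · exact mem_range_sigmaOne_iff.mpr <| by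
      simp only [Sum.elim_inl, Sum.elim_inr, Matrix.cons_val]
      norm_num
  · exact mem_range_sigmaTwoMain_iff.mpr (by simp)
  · exact mem_range_sigmaThree_iff.mpr <| by
      simp only [Sum.elim_inl, Sum.elim_inr, Matrix.cons_val]
      norm_num
  · exact mem_range_sigmaTwoFourthRoots_iff.mpr <| by
      simp only [Sum.elim_inl, Sum.elim_inr, Matrix.cons_val]
      norm_num
  · exact mem_range_sigmaFour_iff.mpr <| by
      simp only [Sum.elim_inl, Sum.elim_inr, Matrix.cons_val]
      norm_num

theorem eq_of_separatingCondition (h : separatingCondition (separatingPoint i) j) : i = j := by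
  contrapose! h
  fin_cases i <;> fin_cases j <;>
    first
    | exact absurd rfl h
    | simp only [Fin.zero_eta, Fin.mk_one, Fin.reduceFinMk, separatingCondition, separatingPoint,
        sigma, Fin.sum_univ_four, Matrix.cons_val, Sum.elim_inl, Sum.elim_inr]
      norm_num

theorem eq_of_permuteExponents_image_subset {τ ρ : Equiv.Perm (Fin 4)}
    (h : permuteExponents τ '' (family i).2.range ⊆ permuteExponents ρ '' (family j).2.range) :
    i = j := by
  have hmem := mem_image_permuteExponents.mp (h ⟨_, separatingPoint_mem_range_family i, rfl⟩)
  have hcond := separatingCondition_of_mem hmem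
  rw [separatingCondition_permuteExponents, separatingCondition_permuteExponents] at hcond
  exact eq_of_separatingCondition hcond

theorem isAntichain_components : IsAntichain (· ⊆ ·) components := by
  rintro _ ⟨⟨i, τ⟩, rfl⟩ _ ⟨⟨j, ρ⟩, rfl⟩ hne h
  obtain rfl := eq_of_permuteExponents_image_subset h
  exact hne (permuteExponents_image_eq_of_subset h)

theorem setOf_isComponent_cySet : {Z | IsComponent cySet Z} = components := by
  rw [cySet_eq_sUnion_components]
  exact setOf_isComponent_sUnion (Set.finite_range _)
    (fun _ => isIrreducibleAlgebraicSet_of_mem_components) isAntichain_components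

theorem existsUnique_eq_permuteExponents_image (hZ : Z ∈ components) :
    ∃! i, ∃ τ, Z = permuteExponents τ '' (family i).2.range := by
  obtain ⟨⟨i, τ⟩, rfl⟩ := hZ
  exact ⟨i, ⟨τ, rfl⟩, fun j ⟨ρ, h⟩ => (eq_of_permuteExponents_image_subset h.subset).symm⟩

theorem f_eq_zero_of_mem_range_family (hi : i < 3) (hp : p ∈ (family i).2.range) :
    p (.inl 5) = 0 := by
  have hcond := separatingCondition_of_mem hp
  match i, hi with
  | 0, _ | 1, _ | 2, _ => exact hcond.1

theorem exists_mem_range_family_f_ne_zero (hi : 3 ≤ i) :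
    ∃ p ∈ (family i).2.range, p (.inl 5) ≠ 0 := by
  refine ⟨_, separatingPoint_mem_range_family i, ?_⟩
  fin_cases i <;> first | exact absurd hi (by decide) | simp [separatingPoint]

theorem exists_mem_range_transverse_sigma_ne :
    ∃ p ∈ transverse.range, ∃ q ∈ transverse.range, sigma p ≠ sigma q :=
  ⟨_, separatingPoint_mem_range_family 3, 0, mem_range_transverse_iff.mpr (by simp),
    by simp [separatingPoint, sigma, Fin.sum_univ_four]⟩

theorem dimension_range_family (i : Fin 10) : dimension (family i).2.range = (family i).1 := by
  rw [PolyEmbedding.dimension_range, Cardinal.mk_fin]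

end Components

end CYDegreeTwo

end

open CYDegreeTwo in
theorem mainTheorem1 :
    IsAlgebraicSet cySet ∧
    cySet = ⋃₀ {Z | IsComponent cySet Z} ∧
    ∃ Y : Fin 10 → Set Param,
      -- the components of `X` are the sets `Y i` up to reordering the exponents,
      -- and no two of the ten are equivalent
      (∀ (i : Fin 10) (τ : Equiv.Perm (Fin 4)),
        IsComponent cySet (permuteExponents τ '' Y i)) ∧
      (∀ Z, IsComponent cySet Z →
        ∃! i, ∃ τ : Equiv.Perm (Fin 4), Z = permuteExponents τ '' Y i) ∧
      -- three components with `f = 0`, seven with `f ≠ 0`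
      (∀ i : Fin 10, i < 3 → ∀ p ∈ Y i, p (.inl 5) = 0) ∧
      (∀ i : Fin 10, 3 ≤ i → ∃ p ∈ Y i, p (.inl 5) ≠ 0) ∧
      -- the transverse component
      (∃ p ∈ Y 3, ∃ q ∈ Y 3, sigma p ≠ sigma q) ∧
      dimension (Y 3) = 5 ∧
      -- the six components on which `σ` is fixed
      (∀ j : Fin 6,
        (∀ p ∈ Y (Fin.natAdd 4 j), sigma p = (![0, 1, 2, 3, 2, 4] : Fin 6 → ℂ) j) ∧
        dimension (Y (Fin.natAdd 4 j)) = ((![4, 5, 6, 5, 4, 4] : Fin 6 → ℕ) j : Cardinal)) ∧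
      -- the main component, the one with `σ = 2` and dimension `6`
      Y 6 = mainFamily := by
  refine ⟨?_, ?_, fun i => (family i).2.range, fun i τ => ?_, fun Z hZ => ?_,
    fun i hi p => f_eq_zero_of_mem_range_family hi,
    fun i hi => exists_mem_range_family_f_ne_zero hi,
    exists_mem_range_transverse_sigma_ne, dimension_range_family 3,
    fun j => ⟨fun p => sigma_eq_of_mem_range_family j, ?_⟩, range_sigmaTwoMain⟩
  · rw [cySet_eq_sUnion_components]
    exact isAlgebraicSet_sUnion (Set.finite_range _)
      fun Z hZ => (isIrreducibleAlgebraicSet_of_mem_components hZ).1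
  · rw [setOf_isComponent_cySet]
    exact cySet_eq_sUnion_components
  · exact setOf_isComponent_cySet.ge ⟨(i, τ), rfl⟩
  · exact existsUnique_eq_permuteExponents_image (setOf_isComponent_cySet.le hZ)
  · rw [dimension_range_family]
    fin_cases j <;> rfl
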